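/- Let $p>1$ and let $V:\mathbb{R}^n\to\mathbb{R}$ be even, strictly convex and $p$-homogeneous, i.e. $V(cx)=c^pV(x)$ for all $c>0$ and $x\in\mathbb{R}^n$. Assume that $V$ is $C^2$, or, more generally, that $V$ is $C^1$ on $\mathbb{R}^n$ and $C^2$ on $\{x: x_i\neq 0 \text{ for all } i\}$. Assume that $V$ is unconditional, i.e. $V(\pm x_1,\dots,\pm x_n)=V(x_1,\dots,x_n)$ for every choice of signs, and that the function $$x=(x_1,\dots,x_n)\mapsto V\bigl(x_1^{1/p},\dots,x_n^{1/p}\bigr)$$ is concave on $\mathbb{R}^n_+=\{x: x_i\ge 0 \text{ for all } i\}$. For a proper convex function $\Phi:\mathbb{R}^n\to(-\infty,+\infty]$ let $\Phi^*(y)=\sup_{x}\bigl(\langle x,y\rangle-\Phi(x)\bigr)$ be its Legendre transform, and consider the inequality $$\int_{\mathbb{R}^n} e^{-\Phi(x)}\,dx\,\left(\int_{\mathbb{R}^n} e^{-\frac{1}{p-1}\Phi^*(\nabla V(y))}\,dy\right)^{p-1}\le\left(\int_{\mathbb{R}^n} e^{-V(x)}\,dx\right)^{p}, \qquad (*)$$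 where the integrals take values in $[0,\infty]$ and $0\cdot\infty=0$. 1. Inequality $(*)$ holds for every unconditional proper convex $\Phi$. 2. Assume, in addition, that for every coordinate vector $e=e_i$ and every $x'\in\mathbb{R}^n$ with $x'_i=0$ the function $$\varphi(t)=\det D^2V^*(x'+te)$$ is decreasing (in the wide sense) on the set of those $t\in[0,\infty)$ for which the Legendre transform $V^*$ is twice differentiable at $x'+te$. Then $(*)$ holds for every even proper convex $\Phi$. -/

import Mathlib

open MeasureTheory Set
open scoped ENNReal Gradient

noncomputable section

/-- `Φ : ℝⁿ → (-∞, +∞]` is a proper convex function. -/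
structure IsProperConvex {n : ℕ} (Φ : EuclideanSpace ℝ (Fin n) → EReal) : Prop where
  ne_bot : ∀ x, Φ x ≠ ⊥
  exists_ne_top : ∃ x, Φ x ≠ ⊤
  convex : ∀ x y : EuclideanSpace ℝ (Fin n), ∀ a b : ℝ, 0 < a → 0 < b → a + b = 1 →
    Φ (a • x + b • y) ≤ (a : EReal) * Φ x + (b : EReal) * Φ y

/-- Invariance under every change of signs of the coordinates:
`f (±x₁, …, ±xₙ) = f (x₁, …, xₙ)`. -/
def IsUnconditional {n : ℕ} {β : Type*} (f : EuclideanSpace ℝ (Fin n) → β) : Prop :=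
  ∀ x y : EuclideanSpace ℝ (Fin n), (∀ i, |x i| = |y i|) → f x = f y

/-- The Legendre transform `Φ*(y) = sup_x (⟨x, y⟩ - Φ x)`. -/
def legendre {n : ℕ} (Φ : EuclideanSpace ℝ (Fin n) → EReal)
    (y : EuclideanSpace ℝ (Fin n)) : EReal :=
  ⨆ x : EuclideanSpace ℝ (Fin n), ((inner ℝ x y : ℝ) : EReal) - Φ x

/-- The Legendre transform of a real function as a real function (faithful where the
supremum is finite, as it is everywhere for a superlinear function). -/
def legendreReal {n : ℕ} (V : EuclideanSpace ℝ (Fin n) → ℝ)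
    (y : EuclideanSpace ℝ (Fin n)) : ℝ :=
  (legendre (fun x => (V x : EReal)) y).toReal

/-- `f` is twice differentiable at `x`, for a function `f` that is differentiable
around `x`. -/
def HasHessianAt {n : ℕ} (f : EuclideanSpace ℝ (Fin n) → ℝ)
    (x : EuclideanSpace ℝ (Fin n)) : Prop :=
  DifferentiableAt ℝ (∇ f) x

/-- `det D²f(x)`, the determinant of the derivative of the gradient. -/
def hessianDet {n : ℕ} (f : EuclideanSpace ℝ (Fin n) → ℝ)
    (x : EuclideanSpace ℝ (Fin n)) : ℝ :=
  (fderiv ℝ (∇ f) x).det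

/-- The functional `∫ e^{-Φ(x)} dx · (∫ e^{-Φ*(∇V(y)) / (p - 1)} dy)^{p - 1}`
with values in `[0, ∞]`. -/
def blaschkeSantalo {n : ℕ} (p : ℝ) (V : EuclideanSpace ℝ (Fin n) → ℝ)
    (Φ : EuclideanSpace ℝ (Fin n) → EReal) : ℝ≥0∞ :=
  (∫⁻ x, EReal.exp (-Φ x)) *
    (∫⁻ y, EReal.exp (-(((1 / (p - 1) : ℝ) : EReal) * legendre Φ (∇ V y)))) ^ (p - 1)

end

/-! Write F = e^{-Φ} and G = e^{-Φ*}, so that F(x) G(z) ≤ e^{-⟨x,z⟩}. For unconditional functions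
the integrals reduce to the positive orthant, where logarithmic coordinates give the
Prékopa–Leindler inequality for coordinatewise geometric means. With weights 1/p and 1 - 1/p,
applied to F and (G ∘ ∇V)^{1/(p-1)}, it yields the claim once V(x^{1/p} y^{1-1/p}) ≤ ⟨x, ∇V(y)⟩/p.
This last bound (`apply_geomMean_le`) is the tangent inequality for the concave function V(x^{1/p}),
combined with Euler's identity. The result is `blaschkeSantalo_of_unconditional`.

For even Φ, the substitution z = ∇V(y) turns the second integral into ∫ G^{1/(p-1)} ω, where ω = det
D²V* off the coordinate hyperplanes (`exists_density`). A functional Steiner symmetrization of G in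
one coordinate increases the integral of the polar of G, by Prékopa–Leindler on hyperplanes
(`lintegral_polarFun_le_steinerFun`). It also increases the weighted integral, by Prékopa–Leindler
on lines, because ω decreases in each |z_i| (`lintegral_mul_le_steinerFun`). Symmetrizing in every
coordinate makes G unconditional, and the first case applies.

The delicate point is the density: D²V may degenerate, but a zero of det D²V off the hyperplanes
would be a blow-up of det D²V*, which its monotonicity excludes (`symmJacobian_pos`). -/

/-! ### Brunn–Minkowski on the line. -/

-- The translates A + min B and max A + B both lie in A + B and can meet only at max A + min B.
open scoped Pointwise in
theorem volume_add_volume_le_of_isCompact {A B : Set ℝ} (hA : IsCompact A) (hB : IsCompact B)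
    (hA' : A.Nonempty) (hB' : B.Nonempty) : volume A + volume B ≤ volume (A + B) := by
  have hα := hA.sSup_mem hA'
  have hβ := hB.sInf_mem hB'
  set α := sSup A
  set β := sInf B
  have h1 : volume ((fun x => x + β) '' A) = volume A := by
    simp [image_add_right]
  have h2 : volume ((fun x => α + x) '' B) = volume B := by
    simp [image_add_left]
  have hd : AEDisjoint volume ((fun x => x + β) '' A) ((fun x => α + x) '' B) := by
    refine measure_mono_null (t := {α + β}) ?_ (by simp)
    rintro _ ⟨⟨x, hx, rfl⟩, ⟨y, hy, hxy⟩⟩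
    have hx' : x ≤ α := le_csSup hA.bddAbove hx
    have hy' : β ≤ y := csInf_le hB.bddBelow hy
    simp only [mem_singleton_iff] at hxy ⊢
    linarith
  have hm : NullMeasurableSet ((fun x => α + x) '' B) volume :=
    (hB.image (by fun_prop)).measurableSet.nullMeasurableSet
  rw [← h1, ← h2, ← measure_union₀ hm hd]
  refine measure_mono ?_
  rintro _ (⟨x, hx, rfl⟩ | ⟨x, hx, rfl⟩)
  · exact add_mem_add hx hβ
  · exact add_mem_add hα hx

/-- The one-dimensional Brunn–Minkowski inequality. -/
theorem volume_add_volume_le {A B C : Set ℝ} (hA : MeasurableSet A) (hB : MeasurableSet B)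
    (hA' : A.Nonempty) (hB' : B.Nonempty) (h : ∀ x ∈ A, ∀ y ∈ B, x + y ∈ C) :
    volume A + volume B ≤ volume C := by
  obtain ⟨x₀, hx₀⟩ := hA'
  obtain ⟨y₀, hy₀⟩ := hB'
  have key : ∀ K ⊆ A, ∀ L ⊆ B, IsCompact K → IsCompact L → volume K + volume L ≤ volume C := by
    intro K hK L hL hKc hLc
    -- The compact sets from inner regularity may be empty; an added point of A or B makes them
    -- nonempty.
    calc volume K + volume L ≤ volume (insert x₀ K) + volume (insert y₀ L) := by
          gcongr <;> exact subset_insert _ _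
      _ ≤ _ := volume_add_volume_le_of_isCompact (hKc.insert _) (hLc.insert _)
          (insert_nonempty _ _) (insert_nonempty _ _)
      _ ≤ volume C := by
          refine measure_mono ?_
          rintro _ ⟨x, hx, y, hy, rfl⟩
          exact h x (insert_subset hx₀ hK hx) y (insert_subset hy₀ hL hy)
  rw [hA.measure_eq_iSup_isCompact, hB.measure_eq_iSup_isCompact]
  simp only [iSup_and']
  refine ENNReal.biSup_add_biSup_le' ⟨∅, by simp⟩ ⟨∅, by simp⟩ ?_
  intro K hK L hL
  exact key K hK.1 L hL.1 hK.2 hL.2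

/-! ### Prékopa–Leindler on the line. -/

theorem ENNReal.rpow_mul_rpow_le_add {a b : ℝ} (ha : 0 < a) (hb : 0 < b) (hab : a + b = 1)
    (x y : ℝ≥0∞) : x ^ a * y ^ b ≤ ENNReal.ofReal a * x + ENNReal.ofReal b * y := by
  induction x with
  | top => simp [ENNReal.mul_top, ha]
  | coe x =>
    induction y with
    | top => simp [ENNReal.mul_top, hb]
    | coe y =>
      rw [← ENNReal.coe_rpow_of_nonneg _ ha.le, ← ENNReal.coe_rpow_of_nonneg _ hb.le,
        ENNReal.ofReal, ENNReal.ofReal]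
      norm_cast
      have := NNReal.geom_mean_le_arith_mean2_weighted a.toNNReal b.toNNReal x y
        (by rw [← Real.toNNReal_add ha.le hb.le, hab, Real.toNNReal_one])
      rwa [Real.coe_toNNReal _ ha.le, Real.coe_toNNReal _ hb.le] at this

/-- The Prékopa–Leindler inequality on the line for functions with supremum `1`. -/
theorem prekopaLeindler_real_of_sup_eq_one {a b : ℝ} (ha : 0 < a) (hb : 0 < b)
    (hab : a + b = 1)
    {f g h : ℝ → ℝ} (hf : Measurable f) (hg : Measurable g) (hh : Measurable h)
    (hf0 : ∀ x, 0 ≤ f x) (hg0 : ∀ x, 0 ≤ g x) (hh0 : ∀ x, 0 ≤ h x)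
    (hf1 : ∀ x, f x ≤ 1) (hg1 : ∀ x, g x ≤ 1)
    (hfs : ∀ t < 1, ∃ x, t < f x) (hgs : ∀ t < 1, ∃ x, t < g x)
    (H : ∀ x y, f x ^ a * g y ^ b ≤ h (a * x + b * y)) :
    ENNReal.ofReal a * (∫⁻ x, ENNReal.ofReal (f x)) +
      ENNReal.ofReal b * (∫⁻ x, ENNReal.ofReal (g x)) ≤ ∫⁻ x, ENNReal.ofReal (h x) := by
  have hmeas : ∀ k : ℝ → ℝ, Measurable fun t => volume {x | t < k x} := fun k =>
    Antitone.measurable fun s t hst => measure_mono fun x hx => lt_of_le_of_lt hst hx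
  rw [lintegral_eq_lintegral_meas_lt _ (ae_of_all _ hf0) hf.aemeasurable,
    lintegral_eq_lintegral_meas_lt _ (ae_of_all _ hg0) hg.aemeasurable,
    lintegral_eq_lintegral_meas_lt _ (ae_of_all _ hh0) hh.aemeasurable,
    ← lintegral_const_mul _ (hmeas f), ← lintegral_const_mul _ (hmeas g),
    ← lintegral_add_left ((hmeas f).const_mul _)]
  -- Layer cake: as both suprema are 1, the level sets of f and g are nonempty for the same t < 1,
  -- and Brunn–Minkowski compares them with that of h.
  refine setLIntegral_mono' measurableSet_Ioi fun t ht => ?_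
  rw [mem_Ioi] at ht
  rcases lt_or_ge t 1 with ht1 | ht1
  · have e1 : ENNReal.ofReal a * volume {x | t < f x} = volume ((fun x => a⁻¹ * x) ⁻¹' {x | t < f x}) := by
      rw [Real.volume_preimage_mul_left (inv_ne_zero ha.ne'), inv_inv, abs_of_pos ha]
    have e2 : ENNReal.ofReal b * volume {x | t < g x} = volume ((fun x => b⁻¹ * x) ⁻¹' {x | t < g x}) := by
      rw [Real.volume_preimage_mul_left (inv_ne_zero hb.ne'), inv_inv, abs_of_pos hb]
    rw [e1, e2]
    refine volume_add_volume_le (measurableSet_lt measurable_const (hf.comp (by fun_prop)))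
      (measurableSet_lt measurable_const (hg.comp (by fun_prop))) ?_ ?_ ?_
    · obtain ⟨x, hx⟩ := hfs t ht1
      exact ⟨a * x, by simpa [ha.ne'] using hx⟩
    · obtain ⟨x, hx⟩ := hgs t ht1
      exact ⟨b * x, by simpa [hb.ne'] using hx⟩
    · intro x hx y hy
      simp only [mem_preimage, mem_ofPred_eq] at hx hy ⊢
      have := H (a⁻¹ * x) (b⁻¹ * y)
      rw [mul_inv_cancel_left₀ ha.ne', mul_inv_cancel_left₀ hb.ne'] at this
      refine lt_of_lt_of_le ?_ this
      calc t = t ^ a * t ^ b := by rw [← Real.rpow_add ht, hab, Real.rpow_one]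
        _ < _ := mul_lt_mul'' (Real.rpow_lt_rpow ht.le hx ha) (Real.rpow_lt_rpow ht.le hy hb)
          (by positivity) (by positivity)
  · have e1 : {x | t < f x} = ∅ := by
      ext x; simpa using (hf1 x).trans ht1
    have e2 : {x | t < g x} = ∅ := by
      ext x; simpa using (hg1 x).trans ht1
    simp [e1, e2]

/-- `μ` satisfies the Prékopa–Leindler inequality with weights `a` and `b`. -/
def IsPrekopaLeindler {E : Type*} [AddCommGroup E] [Module ℝ E] [MeasurableSpace E]
    (a b : ℝ) (μ : Measure E) : Prop :=
  ∀ f g h : E → ℝ≥0∞, Measurable f → Measurable g → Measurable h →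
    (∀ x y, f x ^ a * g y ^ b ≤ h (a • x + b • y)) →
    (∫⁻ x, f x ∂μ) ^ a * (∫⁻ x, g x ∂μ) ^ b ≤ ∫⁻ x, h x ∂μ

theorem ENNReal.iSup_div_self {f : ℝ → ℝ≥0∞} (h0 : (⨆ x, f x) ≠ 0) (ht : (⨆ x, f x) ≠ ⊤) (t : ℝ)
    (h : t < 1) : ∃ x, t < (f x / ⨆ x, f x).toReal := by
  set M := ⨆ x, f x with hM
  have : ENNReal.ofReal t * M < M := by
    conv_rhs => rw [← one_mul M]
    exact ENNReal.mul_lt_mul_left h0 ht (by simpa using h)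
  obtain ⟨x, hx⟩ := lt_iSup_iff.1 (hM ▸ this)
  refine ⟨x, ?_⟩
  rw [← hM] at hx
  have hx' : ENNReal.ofReal t < f x / M := (ENNReal.lt_div_iff_mul_lt (Or.inl h0) (Or.inl ht)).2 hx
  have hne : f x / M ≠ ⊤ := ENNReal.div_ne_top (ne_top_of_le_ne_top ht (le_iSup f x)) h0
  exact lt_of_not_ge fun h' => (not_le.2 hx') (by
    rw [← ENNReal.ofReal_toReal hne]; exact ENNReal.ofReal_le_ofReal h')

/-- Dividing f, g by their suprema M, N and h by M^a N^b reduces to the normalized case; the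
arithmetic-geometric mean inequality then turns the sum into a product. -/
theorem prekopaLeindler_real_of_bdd {a b : ℝ} (ha : 0 < a) (hb : 0 < b) (hab : a + b = 1)
    {f g h : ℝ → ℝ≥0∞} (hf : Measurable f) (hg : Measurable g) (hh : Measurable h)
    (hft : (⨆ x, f x) ≠ ⊤) (hgt : (⨆ x, g x) ≠ ⊤)
    (H : ∀ x y, f x ^ a * g y ^ b ≤ h (a • x + b • y)) :
    (∫⁻ x, f x) ^ a * (∫⁻ x, g x) ^ b ≤ ∫⁻ x, h x := by
  by_cases hf0 : (⨆ x, f x) = 0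
  · have : ∀ x, f x = 0 := by simpa using hf0
    simp [this, ha]
  by_cases hg0 : (⨆ x, g x) = 0
  · have : ∀ x, g x = 0 := by simpa using hg0
    simp [this, hb]
  set M := ⨆ x, f x with hM
  set N := ⨆ x, g x with hN
  set C := M ^ a * N ^ b with hC
  have hC0 : C ≠ 0 := mul_ne_zero (by simp [hf0, hft]) (by simp [hg0, hgt])
  have hCt : C ≠ ⊤ := ENNReal.mul_ne_top (ENNReal.rpow_ne_top_of_nonneg ha.le hft)
    (ENNReal.rpow_ne_top_of_nonneg hb.le hgt)
  have hfM : ∀ x, f x / M ≤ 1 := fun x => ENNReal.div_le_of_le_mul (by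
    rw [one_mul]; exact le_iSup f x)
  have hgN : ∀ x, g x / N ≤ 1 := fun x => ENNReal.div_le_of_le_mul (by
    rw [one_mul]; exact le_iSup g x)
  have hfM' : ∀ x, f x / M ≠ ⊤ := fun x => ne_top_of_le_ne_top ENNReal.one_ne_top (hfM x)
  have hgN' : ∀ x, g x / N ≠ ⊤ := fun x => ne_top_of_le_ne_top ENNReal.one_ne_top (hgN x)
  -- The value of h may be infinite; truncation at 1 loses nothing, since the normalized left side
  -- is at most 1.
  have hm' : ∀ x, min (h x / C) 1 ≠ ⊤ := fun x =>
    ne_top_of_le_ne_top ENNReal.one_ne_top (min_le_right _ _)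
  have key := prekopaLeindler_real_of_sup_eq_one ha hb hab
    (f := fun x => (f x / M).toReal) (g := fun x => (g x / N).toReal)
    (h := fun x => (min (h x / C) 1).toReal) (by fun_prop) (by fun_prop) (by fun_prop)
    (fun _ => ENNReal.toReal_nonneg) (fun _ => ENNReal.toReal_nonneg)
    (fun _ => ENNReal.toReal_nonneg)
    (fun x => ENNReal.toReal_le_of_le_ofReal zero_le_one (by simpa using hfM x))
    (fun x => ENNReal.toReal_le_of_le_ofReal zero_le_one (by simpa using hgN x))
    (ENNReal.iSup_div_self hf0 hft) (ENNReal.iSup_div_self hg0 hgt) (by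
      intro x y
      rw [ENNReal.toReal_rpow, ENNReal.toReal_rpow, ← ENNReal.toReal_mul]
      refine ENNReal.toReal_mono (hm' _) (le_min ?_ ?_)
      · rw [ENNReal.div_rpow_of_nonneg _ _ ha.le, ENNReal.div_rpow_of_nonneg _ _ hb.le]
        refine (ENNReal.le_div_iff_mul_le (Or.inl hC0) (Or.inl hCt)).2 ?_
        have h1 : f x ^ a / M ^ a * M ^ a = f x ^ a :=
          ENNReal.div_mul_cancel (by simp [hf0, hft]) (ENNReal.rpow_ne_top_of_nonneg ha.le hft)
        have h2 : g y ^ b / N ^ b * N ^ b = g y ^ b :=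
          ENNReal.div_mul_cancel (by simp [hg0, hgt]) (ENNReal.rpow_ne_top_of_nonneg hb.le hgt)
        calc f x ^ a / M ^ a * (g y ^ b / N ^ b) * C
            = (f x ^ a / M ^ a * M ^ a) * (g y ^ b / N ^ b * N ^ b) := by rw [hC]; ring
          _ ≤ _ := by rw [h1, h2]; exact H x y
      · exact mul_le_one' (ENNReal.rpow_le_one (hfM x) ha.le) (ENNReal.rpow_le_one (hgN y) hb.le))
  simp only [ENNReal.ofReal_toReal (hfM' _), ENNReal.ofReal_toReal (hgN' _),
    ENNReal.ofReal_toReal (hm' _)] at key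
  have h3 : ∫⁻ x, min (h x / C) 1 ≤ (∫⁻ x, h x) / C := by
    rw [div_eq_mul_inv, ← lintegral_mul_const _ hh]
    exact lintegral_mono fun x => (min_le_left _ _)
  have h4 := (ENNReal.rpow_mul_rpow_le_add ha hb hab _ _).trans (key.trans h3)
  simp only [div_eq_mul_inv] at h4
  rw [lintegral_mul_const _ hf, lintegral_mul_const _ hg, ← div_eq_mul_inv, ← div_eq_mul_inv,
    ← div_eq_mul_inv, ENNReal.div_rpow_of_nonneg _ _ ha.le, ENNReal.div_rpow_of_nonneg _ _ hb.le,
    ENNReal.le_div_iff_mul_le (Or.inl hC0) (Or.inl hCt)] at h4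
  have h1 : (∫⁻ x, f x) ^ a / M ^ a * M ^ a = (∫⁻ x, f x) ^ a :=
    ENNReal.div_mul_cancel (by simp [hf0, hft]) (ENNReal.rpow_ne_top_of_nonneg ha.le hft)
  have h2 : (∫⁻ x, g x) ^ b / N ^ b * N ^ b = (∫⁻ x, g x) ^ b :=
    ENNReal.div_mul_cancel (by simp [hg0, hgt]) (ENNReal.rpow_ne_top_of_nonneg hb.le hgt)
  calc (∫⁻ x, f x) ^ a * (∫⁻ x, g x) ^ b
      = (∫⁻ x, f x) ^ a / M ^ a * ((∫⁻ x, g x) ^ b / N ^ b) * C := by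
        conv_lhs => rw [← h1, ← h2]
        rw [hC]
        ring
    _ ≤ _ := h4

theorem lintegral_eq_iSup_lintegral_min {α : Type*} [MeasurableSpace α] {μ : Measure α}
    {f : α → ℝ≥0∞} (hf : Measurable f) :
    ∫⁻ x, f x ∂μ = ⨆ k : ℕ, ∫⁻ x, min (f x) k ∂μ := by
  rw [← lintegral_iSup (f := fun (k : ℕ) x => min (f x) k) (fun k => by fun_prop)
    (fun k l hkl x => min_le_min_left _ (by exact_mod_cast hkl))]
  refine lintegral_congr fun x => ?_
  rw [← inf_iSup_eq, ENNReal.iSup_natCast, inf_top_eq]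

/-- The Prékopa–Leindler inequality on the line. -/
theorem isPrekopaLeindler_volume_real {a b : ℝ} (ha : 0 < a) (hb : 0 < b) (hab : a + b = 1) :
    IsPrekopaLeindler a b (volume : Measure ℝ) := by
  intro f g h hf hg hh H
  rw [lintegral_eq_iSup_lintegral_min hf, lintegral_eq_iSup_lintegral_min hg,
    ← ENNReal.orderIsoRpow_apply _ ha, ← ENNReal.orderIsoRpow_apply _ hb,
    OrderIso.map_iSup, OrderIso.map_iSup, ENNReal.iSup_mul]
  refine iSup_le fun k => ?_
  rw [ENNReal.mul_iSup]
  refine iSup_le fun l => ?_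
  simp only [ENNReal.orderIsoRpow_apply]
  have hk : ∀ (f : ℝ → ℝ≥0∞) (k : ℕ), (⨆ x, min (f x) k) ≠ ⊤ := fun f k =>
    ne_top_of_le_ne_top (ENNReal.natCast_ne_top k) (iSup_le fun x => min_le_right _ _)
  refine prekopaLeindler_real_of_bdd ha hb hab (by fun_prop) (by fun_prop) hh (hk f k) (hk g l) ?_
  intro x y
  refine le_trans ?_ (H x y)
  gcongr <;> exact min_le_left _ _

/-! ### Tensorization to n dimensions. -/

theorem measurable_insertNth {n : ℕ} (i : Fin (n + 1)) :
    Measurable fun q : ℝ × (Fin n → ℝ) => (i.insertNth q.1 q.2 : Fin (n + 1) → ℝ) :=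
  (MeasurableEquiv.piFinSuccAbove (fun _ : Fin (n + 1) => ℝ) i).symm.measurable

theorem lintegral_pi_eq_insertNth {n : ℕ} (i : Fin (n + 1)) (μ : Measure ℝ) [SigmaFinite μ]
    {f : (Fin (n + 1) → ℝ) → ℝ≥0∞} (hf : Measurable f) :
    ∫⁻ x, f x ∂(Measure.pi fun _ : Fin (n + 1) => μ) =
      ∫⁻ s, ∫⁻ x, f (i.insertNth s x) ∂(Measure.pi fun _ : Fin n => μ) ∂μ := by
  have := (measurePreserving_piFinSuccAbove (fun _ : Fin (n + 1) => μ) i).symm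
  rw [← this.lintegral_comp hf, lintegral_prod]
  · rfl
  · exact (hf.comp (MeasurableEquiv.measurable _)).aemeasurable

theorem smul_insertNth_add_smul_insertNth {n : ℕ} (i : Fin (n + 1)) (a b s t : ℝ)
    (x y : Fin n → ℝ) :
    a • (i.insertNth s x : Fin (n + 1) → ℝ) + b • (i.insertNth t y : Fin (n + 1) → ℝ) =
      i.insertNth (a • s + b • t) (a • x + b • y) := by
  ext j
  refine Fin.succAboveCases i ?_ (fun j => ?_) j <;> simp

/-- Tensorization of the Prékopa–Leindler inequality. -/
theorem IsPrekopaLeindler.pi {a b : ℝ} {μ : Measure ℝ} [SigmaFinite μ]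
    (hμ : IsPrekopaLeindler a b μ) (n : ℕ) :
    IsPrekopaLeindler a b (Measure.pi fun _ : Fin n => μ) := by
  induction n with
  | zero =>
    intro f g h hf hg hh H
    rw [Measure.pi_of_empty _ 0]
    simp only [lintegral_dirac]
    simpa using H 0 0
  | succ n ih =>
    intro f g h hf hg hh H
    have hi := measurable_insertNth (0 : Fin (n + 1))
    have hi' : ∀ s : ℝ, Measurable fun x : Fin n → ℝ =>
        ((0 : Fin (n + 1)).insertNth s x : Fin (n + 1) → ℝ) :=
      fun s => hi.comp measurable_prodMk_left
    rw [lintegral_pi_eq_insertNth 0 μ hf, lintegral_pi_eq_insertNth 0 μ hg,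
      lintegral_pi_eq_insertNth 0 μ hh]
    refine hμ _ _ _ (hf.comp hi).lintegral_prod_right' (hg.comp hi).lintegral_prod_right'
      (hh.comp hi).lintegral_prod_right' fun s t => ?_
    refine ih _ _ _ (hf.comp (hi' _)) (hg.comp (hi' _)) (hh.comp (hi' _)) fun x y => ?_
    rw [← smul_insertNth_add_smul_insertNth]
    exact H _ _

/-! ### Logarithmic coordinates on the positive orthant. -/

/-- The measure `2 eˢ ds` on the line, whose image under `exp` is the image of Lebesgue measure
under `abs`. -/
noncomputable def expMeasure : Measure ℝ :=
  (volume : Measure ℝ).withDensity fun s => 2 * ENNReal.ofReal (Real.exp s)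

theorem measurable_two_mul_ofReal_exp :
    Measurable fun s : ℝ => 2 * ENNReal.ofReal (Real.exp s) := by fun_prop

instance : SigmaFinite expMeasure :=
  SigmaFinite.withDensity_of_ne_top'
    (fun _ => ENNReal.mul_ne_top (by simp) ENNReal.ofReal_ne_top)

instance : SigmaFinite ((2 : ℝ≥0∞) • volume.restrict (Ioi (0 : ℝ))) := by
  have : ((2 : ℝ≥0∞) • volume.restrict (Ioi (0 : ℝ))) = (2 : NNReal) • volume.restrict (Ioi 0) :=
    rfl
  rw [this]
  infer_instance

theorem measurePreserving_exp_expMeasure :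
    MeasurePreserving Real.exp expMeasure ((2 : ℝ≥0∞) • volume.restrict (Ioi (0 : ℝ))) := by
  refine ⟨Real.measurable_exp, ?_⟩
  ext s hs
  rw [Measure.map_apply Real.measurable_exp hs, expMeasure,
    withDensity_apply _ (Real.measurable_exp hs), Measure.smul_apply,
    Measure.restrict_apply hs, smul_eq_mul, lintegral_const_mul _ (by fun_prop)]
  congr 1
  have := lintegral_image_eq_lintegral_abs_deriv_mul (s := Real.exp ⁻¹' s)
    (Real.measurable_exp hs) (fun x _ => (Real.hasDerivAt_exp x).hasDerivWithinAt)
    Real.exp_injective.injOn (fun _ => 1)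
  simp only [lintegral_one, Measure.restrict_apply_univ, mul_one, Real.abs_exp] at this
  rw [← this, image_preimage_eq_inter_range, Real.range_exp]

theorem measurePreserving_abs :
    MeasurePreserving (fun x : ℝ => |x|) volume
      ((2 : ℝ≥0∞) • volume.restrict (Ioi (0 : ℝ))) := by
  refine ⟨by fun_prop, ?_⟩
  ext s hs
  have hs' : MeasurableSet (s ∩ Ioi 0) := hs.inter measurableSet_Ioi
  rw [Measure.map_apply (by fun_prop) hs, Measure.smul_apply, Measure.restrict_apply hs,
    smul_eq_mul]
  have h1 : ((fun x : ℝ => |x|) ⁻¹' s : Set ℝ) =ᵐ[volume]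
      (s ∩ Ioi 0 ∪ (fun x => -x) ⁻¹' (s ∩ Ioi 0) : Set ℝ) := by
    filter_upwards [Measure.ae_ne volume (0 : ℝ)] with x hx
    refine propext ?_
    change |x| ∈ s ↔ (x ∈ s ∧ 0 < x) ∨ (-x ∈ s ∧ 0 < -x)
    rcases lt_or_gt_of_ne hx with h | h
    · simp [abs_of_neg h, h, h.le]
    · simp [abs_of_pos h, h, h.le]
  rw [measure_congr h1, measure_union _ (measurable_neg hs'), Measure.measure_preimage_neg,
    two_mul]
  rw [Set.disjoint_left]
  rintro x ⟨_, hx⟩ ⟨_, hx'⟩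
  simp only [mem_Ioi] at hx hx'
  linarith

/-- An unconditional function is integrated over the positive orthant in logarithmic
coordinates. -/
theorem lintegral_eq_lintegral_exp {n : ℕ} {f : (Fin n → ℝ) → ℝ≥0∞} (hf : Measurable f)
    (hu : ∀ x, f (fun i => |x i|) = f x) :
    ∫⁻ x, f x = ∫⁻ s, f (fun i => Real.exp (s i)) ∂(Measure.pi fun _ : Fin n => expMeasure) := by
  have h1 := measurePreserving_pi (ι := Fin n) (fun _ => (volume : Measure ℝ)) _
    (fun _ => measurePreserving_abs)
  have h2 := measurePreserving_pi (ι := Fin n) (fun _ => expMeasure) _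
    (fun _ => measurePreserving_exp_expMeasure)
  rw [h2.lintegral_comp hf, ← h1.lintegral_comp hf]
  simp only [hu]
  rfl

/-- The density 2eˢ is log-affine and so can be absorbed into f, g and h, with 2^a 2^b = 2. -/
theorem isPrekopaLeindler_expMeasure {a b : ℝ} (ha : 0 < a) (hb : 0 < b) (hab : a + b = 1) :
    IsPrekopaLeindler a b expMeasure := by
  intro f g h hf hg hh H
  have hm := measurable_two_mul_ofReal_exp
  rw [expMeasure, lintegral_withDensity_eq_lintegral_mul _ hm hf,
    lintegral_withDensity_eq_lintegral_mul _ hm hg, lintegral_withDensity_eq_lintegral_mul _ hm hh]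
  refine isPrekopaLeindler_volume_real ha hb hab _ _ _ (hm.mul hf) (hm.mul hg) (hm.mul hh) ?_
  intro s t
  simp only [Pi.mul_apply]
  have h2 : (2 * ENNReal.ofReal (Real.exp s)) ^ a * (2 * ENNReal.ofReal (Real.exp t)) ^ b =
      2 * ENNReal.ofReal (Real.exp (a • s + b • t)) := by
    have e2 : (2 : ℝ≥0∞) = ENNReal.ofReal 2 := by simp
    rw [e2, ← ENNReal.ofReal_mul (by norm_num), ← ENNReal.ofReal_mul (by norm_num),
      ← ENNReal.ofReal_mul (by norm_num), ENNReal.ofReal_rpow_of_pos (by positivity),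
      ENNReal.ofReal_rpow_of_pos (by positivity), ← ENNReal.ofReal_mul (by positivity)]
    congr 1
    rw [Real.mul_rpow (by norm_num) (by positivity), Real.mul_rpow (by norm_num) (by positivity),
      ← Real.exp_mul, ← Real.exp_mul, smul_eq_mul, smul_eq_mul, Real.exp_add]
    calc (2 : ℝ) ^ a * Real.exp (s * a) * (2 ^ b * Real.exp (t * b))
        = (2 ^ a * 2 ^ b) * (Real.exp (s * a) * Real.exp (t * b)) := by ring
      _ = _ := by rw [← Real.rpow_add (by norm_num), hab, Real.rpow_one, mul_comm s, mul_comm t]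
  calc (2 * ENNReal.ofReal (Real.exp s) * f s) ^ a * (2 * ENNReal.ofReal (Real.exp t) * g t) ^ b
      = ((2 * ENNReal.ofReal (Real.exp s)) ^ a * (2 * ENNReal.ofReal (Real.exp t)) ^ b) *
        (f s ^ a * g t ^ b) := by
        rw [ENNReal.mul_rpow_of_nonneg _ _ ha.le, ENNReal.mul_rpow_of_nonneg _ _ hb.le]
        ring
    _ ≤ _ := by rw [h2]; gcongr; exact H s t

/-! ### The inequality for unconditional functions. -/

/-- Here D stands for ∇V. Since (1 - 1/p)/(p - 1) = 1/p, the Prékopa–Leindler product is (F(x) G(D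
y))^{1/p} ≤ e^{-⟨x, D y⟩/p}, which `H` bounds by e^{-v} at the geometric mean. -/
theorem blaschkeSantalo_of_unconditional {n : ℕ} {p : ℝ} (hp : 1 < p) {v : (Fin n → ℝ) → ℝ}
    (hv : Measurable v) (hvu : ∀ x, v (fun i => |x i|) = v x)
    {D : (Fin n → ℝ) → (Fin n → ℝ)} (hD : Measurable D)
    (H : ∀ x y, (∀ i, 0 < x i) → (∀ i, 0 < y i) →
      v (fun i => x i ^ (1 / p) * y i ^ (1 - 1 / p)) ≤ (x ⬝ᵥ D y) / p)
    {F G : (Fin n → ℝ) → ℝ≥0∞} (hF : Measurable F) (hG : Measurable G)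
    (hFu : ∀ x, F (fun i => |x i|) = F x) (hGu : ∀ y, G (D (fun i => |y i|)) = G (D y))
    (hFG : ∀ x z, F x * G z ≤ ENNReal.ofReal (Real.exp (-(x ⬝ᵥ z)))) :
    (∫⁻ x, F x) * (∫⁻ y, G (D y) ^ (1 / (p - 1))) ^ (p - 1) ≤
      (∫⁻ x, ENNReal.ofReal (Real.exp (-v x))) ^ p := by
  have hp0 : 0 < p := by linarith
  have hp1 : 0 < p - 1 := by linarith
  have hb : 0 < 1 - 1 / p := by
    rw [sub_pos, div_lt_one hp0]; exact hp
  have hexp : Measurable fun s : Fin n → ℝ => fun i => Real.exp (s i) := by fun_prop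
  have hg : Measurable fun y => G (D y) ^ (1 / (p - 1)) := (hG.comp hD).pow_const _
  have hh : Measurable fun x => ENNReal.ofReal (Real.exp (-v x)) := by fun_prop
  have key := ((isPrekopaLeindler_expMeasure (a := 1 / p) (b := 1 - 1 / p) (by positivity) hb
    (by ring)).pi n) _ _ _ (hF.comp hexp) (hg.comp hexp) (hh.comp hexp) (by
      intro s t
      simp only [Function.comp]
      rw [← ENNReal.rpow_mul]
      have e : 1 / (p - 1) * (1 - 1 / p) = 1 / p := by field_simp
      rw [e, ← ENNReal.mul_rpow_of_nonneg _ _ (by positivity)]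
      refine (ENNReal.rpow_le_rpow (hFG _ _) (by positivity)).trans ?_
      rw [ENNReal.ofReal_rpow_of_pos (Real.exp_pos _), ← Real.exp_mul]
      refine ENNReal.ofReal_le_ofReal (Real.exp_le_exp.2 ?_)
      have := H (fun i => Real.exp (s i)) (fun i => Real.exp (t i)) (fun i => Real.exp_pos _)
        (fun i => Real.exp_pos _)
      have e2 : (fun i => Real.exp ((((1 / p) • s + (1 - 1 / p) • t) : Fin n → ℝ) i)) =
          fun i => Real.exp (s i) ^ (1 / p) * Real.exp (t i) ^ (1 - 1 / p) := by
        ext i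
        rw [← Real.exp_mul, ← Real.exp_mul, ← Real.exp_add]
        congr 1
        simp
        ring
      rw [e2]
      have e3 : ∀ q : ℝ, -q * (1 / p) = -(q / p) := fun q => by ring
      rw [e3]
      linarith)
  simp only [Function.comp] at key
  rw [← lintegral_eq_lintegral_exp hF hFu, ← lintegral_eq_lintegral_exp hg (fun x => by rw [hGu]),
    ← lintegral_eq_lintegral_exp hh (fun x => by rw [hvu])] at key
  have := ENNReal.rpow_le_rpow key hp0.le
  rw [ENNReal.mul_rpow_of_nonneg _ _ hp0.le, ← ENNReal.rpow_mul, ← ENNReal.rpow_mul,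
    one_div_mul_cancel hp0.ne', ENNReal.rpow_one] at this
  have e4 : (1 - 1 / p) * p = p - 1 := by field_simp
  rwa [e4] at this

/-! ### Multiplicative polarity. -/

/-- The multiplicative polar `x ↦ inf_z e^{-⟨x, z⟩} / G z`. -/
noncomputable def polarFun {n : ℕ} (G : (Fin n → ℝ) → ℝ≥0∞) (x : Fin n → ℝ) : ℝ≥0∞ :=
  ⨅ z, ENNReal.ofReal (Real.exp (-(x ⬝ᵥ z))) / G z

/-- The numerator is positive and finite, so the quotient by G z behaves correctly at 0 and ∞ too.
-/
theorem le_polarFun_iff {n : ℕ} {G : (Fin n → ℝ) → ℝ≥0∞} {x : Fin n → ℝ} {c : ℝ≥0∞} :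
    c ≤ polarFun G x ↔ ∀ z, c * G z ≤ ENNReal.ofReal (Real.exp (-(x ⬝ᵥ z))) := by
  rw [polarFun, le_iInf_iff]
  refine forall_congr' fun z => ENNReal.le_div_iff_mul_le (Or.inr ?_) (Or.inr ENNReal.ofReal_ne_top)
  simpa using Real.exp_pos _

theorem polarFun_mul_le {n : ℕ} (G : (Fin n → ℝ) → ℝ≥0∞) (x z : Fin n → ℝ) :
    polarFun G x * G z ≤ ENNReal.ofReal (Real.exp (-(x ⬝ᵥ z))) :=
  le_polarFun_iff.1 le_rfl z

theorem le_polarFun_polarFun {n : ℕ} (G : (Fin n → ℝ) → ℝ≥0∞) (x : Fin n → ℝ) :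
    G x ≤ polarFun (polarFun G) x :=
  le_polarFun_iff.2 fun z => by
    rw [mul_comm, dotProduct_comm]
    exact polarFun_mul_le G z x

/-- An infimum of continuous functions of x is upper semicontinuous, however irregular G is. -/
theorem measurable_polarFun {n : ℕ} (G : (Fin n → ℝ) → ℝ≥0∞) : Measurable (polarFun G) := by
  refine UpperSemicontinuous.measurable (upperSemicontinuous_iInf fun z => ?_)
  refine Continuous.upperSemicontinuous ?_
  by_cases h : G z = 0
  · have : (fun x : Fin n → ℝ => ENNReal.ofReal (Real.exp (-(x ⬝ᵥ z))) / G z) = fun _ => ⊤ := by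
      ext x
      rw [h, ENNReal.div_zero]
      simpa using Real.exp_pos _
    rw [this]
    exact continuous_const
  · refine (ENNReal.continuous_mul_const (ENNReal.inv_ne_top.2 h)).comp ?_
    refine ENNReal.continuous_ofReal.comp (Real.continuous_exp.comp (Continuous.neg ?_))
    unfold dotProduct
    fun_prop

theorem polarFun_mul_sign {n : ℕ} {G : (Fin n → ℝ) → ℝ≥0∞} {ε : Fin n → ℝ} (hε : ε * ε = 1)
    (hG : ∀ z, G (ε * z) = G z) (x : Fin n → ℝ) : polarFun G (ε * x) = polarFun G x := by
  have key : ∀ x, polarFun G (ε * x) ≤ polarFun G x := by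
    intro x
    refine le_polarFun_iff.2 fun z => ?_
    have := polarFun_mul_le G (ε * x) (ε * z)
    rw [hG] at this
    convert this using 4
    refine Finset.sum_congr rfl fun i _ => ?_
    have : ε i * ε i = 1 := congrFun hε i
    simp only [Pi.mul_apply]
    linear_combination (-(x i * z i)) * this
  refine le_antisymm (key x) ?_
  have := key (ε * x)
  rwa [← mul_assoc, hε, one_mul] at this

/-! ### Steiner symmetrization and the integral of the polar. -/

/-- Functional Steiner symmetrization in the `i`-th coordinate:
`(sup_t G (z + t eᵢ) G (σᵢ z + t eᵢ))^{1/2}` with the reflection `σᵢ`. -/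
noncomputable def steinerFun {n : ℕ} (i : Fin n) (G : (Fin n → ℝ) → ℝ≥0∞) (z : Fin n → ℝ) : ℝ≥0∞ :=
  ⨆ t : ℝ, (G (Function.update z i (z i + t)) * G (Function.update z i (t - z i))) ^ (1 / 2 : ℝ)

theorem steinerFun_mul_sign {n : ℕ} (i : Fin n) {G : (Fin n → ℝ) → ℝ≥0∞} {ε : Fin n → ℝ}
    (hε : ε * ε = 1) (hG : ∀ z, G (ε * z) = G z) (z : Fin n → ℝ) :
    steinerFun i G (ε * z) = steinerFun i G z := by
  have key : ∀ z, steinerFun i G (ε * z) ≤ steinerFun i G z := by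
    intro z
    refine iSup_le fun t => ?_
    refine le_trans (le_of_eq ?_) (le_iSup _ (ε i * t))
    have hi : ε i * ε i = 1 := congrFun hε i
    have h : ∀ s, G (Function.update (ε * z) i s) = G (Function.update z i (ε i * s)) := by
      intro s
      rw [← hG (Function.update z i (ε i * s))]
      congr 1
      ext j
      by_cases hj : j = i
      · subst hj
        simp [← mul_assoc, hi]
      · simp [hj]
    rw [h, h]
    simp only [Pi.mul_apply]
    rw [show ε i * (ε i * z i + t) = z i + ε i * t by linear_combination z i * hi,
      show ε i * (t - ε i * z i) = ε i * t - z i by linear_combination (-z i) * hi]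
  refine le_antisymm (key z) ?_
  have := key (ε * z)
  rwa [← mul_assoc, hε, one_mul] at this

/-- The vector of signs that flips the `i`-th coordinate. -/
def signFlip {n : ℕ} (i : Fin n) : Fin n → ℝ := Function.update 1 i (-1)

/-- The reflection exchanges the two factors under the supremum. -/
theorem steinerFun_signFlip {n : ℕ} (i : Fin n) (G : (Fin n → ℝ) → ℝ≥0∞) (z : Fin n → ℝ) :
    steinerFun i G (signFlip i * z) = steinerFun i G z := by
  have : signFlip i * z = Function.update z i (-z i) := by
    ext j
    by_cases hj : j = i
    · subst hj; simp [signFlip]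
    · simp [hj, signFlip]
  rw [this]
  unfold steinerFun
  refine iSup_congr fun t => ?_
  simp only [Function.update_idem, Function.update_self]
  rw [mul_comm, sub_neg_eq_add, add_comm t, neg_add_eq_sub]

theorem dotProduct_insertNth_update {m : ℕ} (i : Fin (m + 1)) (r s : ℝ) (a : Fin m → ℝ)
    (z : Fin (m + 1) → ℝ) :
    (i.insertNth r a : Fin (m + 1) → ℝ) ⬝ᵥ Function.update z i s =
      r * s + ∑ j, a j * z (i.succAbove j) := by
  simp [dotProduct, Fin.sum_univ_succAbove _ i]

/-- In the slices at heights r and -r the shift t contributes rt and -rt to the two pairings and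
cancels in their half-sum. -/
theorem polarFun_rpow_mul_le {m : ℕ} (i : Fin (m + 1)) (G : (Fin (m + 1) → ℝ) → ℝ≥0∞) (r : ℝ)
    (a b : Fin m → ℝ) :
    polarFun G (i.insertNth r a) ^ (1 / 2 : ℝ) * polarFun G (i.insertNth (-r) b) ^ (1 / 2 : ℝ) ≤
      polarFun (steinerFun i G) (i.insertNth r ((1 / 2 : ℝ) • a + (1 / 2 : ℝ) • b)) := by
  refine le_polarFun_iff.2 fun z => ?_
  rw [steinerFun, ENNReal.mul_iSup]
  refine iSup_le fun t => ?_
  have h1 := polarFun_mul_le G (i.insertNth r a) (Function.update z i (z i + t))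
  have h2 := polarFun_mul_le G (i.insertNth (-r) b) (Function.update z i (t - z i))
  have h3 := ENNReal.rpow_le_rpow (mul_le_mul' h1 h2) (by norm_num : (0 : ℝ) ≤ 1 / 2)
  rw [← ENNReal.ofReal_mul (by positivity), ← Real.exp_add,
    ENNReal.ofReal_rpow_of_pos (by positivity), ← Real.exp_mul, mul_mul_mul_comm,
    ENNReal.mul_rpow_of_nonneg _ _ (by norm_num : (0 : ℝ) ≤ 1 / 2),
    ENNReal.mul_rpow_of_nonneg _ _ (by norm_num : (0 : ℝ) ≤ 1 / 2)] at h3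
  refine h3.trans (le_of_eq ?_)
  congr 2
  conv_rhs => rw [← Function.update_eq_self i z]
  rw [dotProduct_insertNth_update, dotProduct_insertNth_update, dotProduct_insertNth_update]
  have : ∑ j, ((1 / 2 : ℝ) • a + (1 / 2 : ℝ) • b) j * z (i.succAbove j) =
      (1 / 2) * ∑ j, a j * z (i.succAbove j) + (1 / 2) * ∑ j, b j * z (i.succAbove j) := by
    rw [Finset.mul_sum, Finset.mul_sum, ← Finset.sum_add_distrib]
    refine Finset.sum_congr rfl fun j _ => ?_
    simp
    ring
  rw [this]
  ring

theorem isPrekopaLeindler_half (m : ℕ) :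
    IsPrekopaLeindler (1 / 2) (1 / 2) (volume : Measure (Fin m → ℝ)) :=
  (isPrekopaLeindler_volume_real (by norm_num) (by norm_num) (by norm_num)).pi m

theorem rpow_half_mul_self (x : ℝ≥0∞) : x ^ (1 / 2 : ℝ) * x ^ (1 / 2 : ℝ) = x := by
  rw [← ENNReal.rpow_add_of_nonneg _ _ (by norm_num) (by norm_num)]
  norm_num

/-- Prékopa–Leindler with weights 1/2 compares the slices of the polar at r and -r, whose integrals
agree by evenness, with the slice of the new polar at r. -/
theorem lintegral_polarFun_le_steinerFun {m : ℕ} (i : Fin (m + 1))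
    {G : (Fin (m + 1) → ℝ) → ℝ≥0∞} (hG : ∀ z, G (-z) = G z) :
    ∫⁻ x, polarFun G x ≤ ∫⁻ x, polarFun (steinerFun i G) x := by
  rw [volume_pi, lintegral_pi_eq_insertNth i volume (measurable_polarFun G),
    lintegral_pi_eq_insertNth i volume (measurable_polarFun _)]
  refine lintegral_mono fun r => ?_
  have hi : ∀ s : ℝ, Measurable fun x : Fin m → ℝ => (i.insertNth s x : Fin (m + 1) → ℝ) :=
    fun s => (measurable_insertNth i).comp measurable_prodMk_left
  have hev : ∀ x, polarFun G (-x) = polarFun G x := by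
    intro x
    have := polarFun_mul_sign (G := G) (ε := -1) (by simp) (by simpa using hG) x
    simpa using this
  have hneg : ∫⁻ x : Fin m → ℝ, polarFun G (i.insertNth (-r) x) =
      ∫⁻ x : Fin m → ℝ, polarFun G (i.insertNth r x) := by
    refine Eq.trans ?_ ((Measure.measurePreserving_neg (volume : Measure (Fin m → ℝ))).lintegral_comp
      ((measurable_polarFun G).comp (hi r)))
    refine lintegral_congr fun x => ?_
    rw [← hev]
    congr 1
    ext j
    refine Fin.succAboveCases i ?_ (fun j => ?_) j <;> simp
  have key := isPrekopaLeindler_half m _ _ _ ((measurable_polarFun G).comp (hi r))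
    ((measurable_polarFun G).comp (hi (-r)))
    ((measurable_polarFun (steinerFun i G)).comp (hi r))
    (fun a b => polarFun_rpow_mul_le i G r a b)
  simp only [Function.comp] at key
  rw [hneg, rpow_half_mul_self] at key
  exact key

/-! ### Steiner symmetrization and the weighted integral. -/

/-- The level sets of ω are symmetric intervals up to the point 0. On each of them Prékopa–Leindler
is applied to k(s) and k(-s), which have equal integrals. -/
theorem lintegral_mul_le_of_symmDecreasing {k K : ℝ → ℝ≥0∞} (hk : Measurable k)
    (hK : Measurable K) (hkK : ∀ s t, k s ^ (1 / 2 : ℝ) * k (-t) ^ (1 / 2 : ℝ) ≤ K ((s + t) / 2))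
    {ω : ℝ → ℝ} (hω : Measurable ω) (hω0 : ∀ s, 0 ≤ ω s)
    (hωs : ∀ s t, t ≠ 0 → |t| ≤ |s| → ω s ≤ ω t) :
    ∫⁻ s, k s * ENNReal.ofReal (ω s) ≤ ∫⁻ s, K s * ENNReal.ofReal (ω s) := by
  have hω' : Measurable fun s => ENNReal.ofReal (ω s) := by fun_prop
  have e : ∀ k : ℝ → ℝ≥0∞, Measurable k → ∫⁻ s, k s * ENNReal.ofReal (ω s) =
      ∫⁻ t in Ioi 0, ∫⁻ s in {s | t < ω s}, k s := by
    intro k hk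
    have := lintegral_withDensity_eq_lintegral_mul volume hk hω'
    simp only [Pi.mul_apply] at this
    rw [← this, lintegral_eq_lintegral_meas_lt _ (ae_of_all _ hω0) hω.aemeasurable]
    refine lintegral_congr fun t => ?_
    rw [withDensity_apply _ (measurableSet_lt measurable_const hω)]
  rw [e k hk, e K hK]
  refine lintegral_mono fun l => ?_
  have hL : MeasurableSet {s | l < ω s} := measurableSet_lt measurable_const hω
  set L := {s | l < ω s} with hLdef
  have hL' : ∀ s ∈ L, ∀ t, t ≠ 0 → |t| ≤ |s| → t ∈ L := fun s hs t ht hst =>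
    lt_of_lt_of_le hs (hωs s t ht hst)
  -- The level set may miss 0; adding this null point makes it closed under the midpoints (s + t)/2
  -- below.
  have h0 : MeasurableSet (L ∪ {0}) := hL.union (measurableSet_singleton 0)
  have hKL : ∫⁻ s in L ∪ {0}, K s = ∫⁻ s in L, K s := by
    refine setLIntegral_congr ?_
    filter_upwards [Measure.ae_ne volume (0 : ℝ)] with x hx
    refine propext ?_
    change (x ∈ L ∨ x = 0) ↔ x ∈ L
    simp [hx]
  rw [← hKL, ← lintegral_indicator hL, ← lintegral_indicator h0]
  have hf : Measurable (L.indicator k) := hk.indicator hL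
  have hneg : ∫⁻ s, L.indicator k (-s) = ∫⁻ s, L.indicator k s :=
    (Measure.measurePreserving_neg (volume : Measure ℝ)).lintegral_comp hf
  have key := isPrekopaLeindler_volume_real (a := 1 / 2) (b := 1 / 2) (by norm_num) (by norm_num)
    (by norm_num) _ _ _ hf (hf.comp measurable_neg) (hK.indicator h0) (by
      intro s t
      by_cases hs : s ∈ L
      · by_cases ht : -t ∈ L
        · have hst : (1 / 2 : ℝ) • s + (1 / 2 : ℝ) • t = (s + t) / 2 := by
            simp only [smul_eq_mul]; ring
          have hm : (s + t) / 2 ∈ L ∪ {0} := by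
            by_cases h : (s + t) / 2 = 0
            · exact Or.inr h
            · left
              have hab : |(s + t) / 2| ≤ max |s| |(-t)| := by
                rw [abs_neg, abs_div, abs_two, div_le_iff₀ (by norm_num)]
                have := abs_add_le s t
                have := le_max_left |s| |t|
                have := le_max_right |s| |t|
                linarith
              rcases le_max_iff.1 hab with h' | h'
              · exact hL' s hs _ h h'
              · exact hL' _ ht _ h h'
          rw [hst, Function.comp_apply, indicator_of_mem hs, indicator_of_mem ht,
            indicator_of_mem hm]
          exact hkK s t
        · simp [indicator_of_notMem ht]
      · simp [indicator_of_notMem hs])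
  simp only [Function.comp] at key
  rw [hneg, rpow_half_mul_self] at key
  exact key

theorem lintegral_mul_le_steinerFun {m : ℕ} (i : Fin (m + 1)) {c : ℝ} (hc : 0 ≤ c)
    {G G' : (Fin (m + 1) → ℝ) → ℝ≥0∞} (hG : Measurable G) (hG' : Measurable G')
    (hGG' : ∀ z, steinerFun i G z ≤ G' z) {ω : (Fin (m + 1) → ℝ) → ℝ} (hω : Measurable ω)
    (hω0 : ∀ z, 0 ≤ ω z)
    (hωs : ∀ z t, t ≠ 0 → |t| ≤ |z i| → ω z ≤ ω (Function.update z i t)) :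
    ∫⁻ z, G z ^ c * ENNReal.ofReal (ω z) ≤ ∫⁻ z, G' z ^ c * ENNReal.ofReal (ω z) := by
  have hmG : Measurable fun z => G z ^ c * ENNReal.ofReal (ω z) := by fun_prop
  have hmG' : Measurable fun z => G' z ^ c * ENNReal.ofReal (ω z) := by fun_prop
  rw [volume_pi, lintegral_pi_eq_insertNth i volume hmG, lintegral_pi_eq_insertNth i volume hmG',
    lintegral_lintegral_swap (f := fun s x =>
      G (i.insertNth s x) ^ c * ENNReal.ofReal (ω (i.insertNth s x))) (hmG.comp (measurable_insertNth i)).aemeasurable,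
    lintegral_lintegral_swap (f := fun s x =>
      G' (i.insertNth s x) ^ c * ENNReal.ofReal (ω (i.insertNth s x))) (hmG'.comp (measurable_insertNth i)).aemeasurable]
  refine lintegral_mono fun z => ?_
  have hi : Measurable fun s : ℝ => (i.insertNth s z : Fin (m + 1) → ℝ) :=
    (measurable_insertNth i).comp measurable_prodMk_right
  refine lintegral_mul_le_of_symmDecreasing ((hG.comp hi).pow_const c) ((hG'.comp hi).pow_const c)
    ?_ (hω.comp hi) (fun s => hω0 _) ?_
  · intro s t
    have h1 := hGG' (i.insertNth ((s + t) / 2) z)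
    -- Centre (s + t)/2 and shift (s - t)/2 give the two arguments s and -t.
    have h2 := (le_iSup (fun r : ℝ => (G (Function.update (i.insertNth ((s + t) / 2) z) i
      ((i.insertNth ((s + t) / 2) z : Fin (m + 1) → ℝ) i + r)) *
      G (Function.update (i.insertNth ((s + t) / 2) z) i
      (r - (i.insertNth ((s + t) / 2) z : Fin (m + 1) → ℝ) i))) ^ (1 / 2 : ℝ)) ((s - t) / 2)).trans h1
    simp only [Fin.insertNth_apply_same, Fin.update_insertNth] at h2
    rw [show (s + t) / 2 + (s - t) / 2 = s by ring, show (s - t) / 2 - (s + t) / 2 = -t by ring] at h2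
    have h3 := ENNReal.rpow_le_rpow h2 hc
    simp only [Function.comp]
    refine le_trans (le_of_eq ?_) h3
    rw [← ENNReal.rpow_mul, ← ENNReal.rpow_mul, ← ENNReal.rpow_mul, mul_comm c,
      ENNReal.mul_rpow_of_nonneg _ _ (by positivity)]
  · intro s t ht hst
    have := hωs (i.insertNth s z) t ht (by simpa using hst)
    simpa [Fin.update_insertNth] using this

/-! ### Symmetrization in all coordinates and the inequality for even functions. -/

theorem signFlip_mul_self {n : ℕ} (i : Fin n) :
    signFlip i * signFlip i = 1 := by
  ext j
  by_cases hj : j = i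
  · subst hj; simp [signFlip]
  · simp [hj, signFlip]

theorem exists_symmetrization {n : ℕ} {c : ℝ} (hc : 0 ≤ c) {ω : (Fin n → ℝ) → ℝ}
    (hω : Measurable ω) (hω0 : ∀ z, 0 ≤ ω z)
    (hωs : ∀ z i t, t ≠ 0 → |t| ≤ |z i| → ω z ≤ ω (Function.update z i t))
    {G : (Fin n → ℝ) → ℝ≥0∞} (hG : Measurable G) (hGe : ∀ z, G (-z) = G z) (S : Finset (Fin n)) :
    ∃ G' : (Fin n → ℝ) → ℝ≥0∞, Measurable G' ∧ (∀ z, G' (-z) = G' z) ∧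
      (∀ i ∈ S, ∀ z, G' (signFlip i * z) = G' z) ∧
      ∫⁻ x, polarFun G x ≤ ∫⁻ x, polarFun G' x ∧
      ∫⁻ z, G z ^ c * ENNReal.ofReal (ω z) ≤ ∫⁻ z, G' z ^ c * ENNReal.ofReal (ω z) := by
  induction S using Finset.induction_on with
  | empty => exact ⟨G, hG, hGe, by simp, le_rfl, le_rfl⟩
  | insert i S hi ih =>
    obtain ⟨G', hG', hGe', hGs', h1, h2⟩ := ih
    cases n with
    | zero => exact i.elim0
    | succ m =>
      have hinv : ∀ ε : Fin (m + 1) → ℝ, ε * ε = 1 →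
          (∀ z, steinerFun i G' (ε * z) = steinerFun i G' z) → ∀ z,
          polarFun (polarFun (steinerFun i G')) (ε * z) =
            polarFun (polarFun (steinerFun i G')) z :=
        fun ε hε h => polarFun_mul_sign hε (polarFun_mul_sign hε h)
      -- An uncountable supremum such as `steinerFun` need not be measurable. Its double polar is,
      -- dominates it, and keeps its symmetries; nor does the integral of its polar drop.
      refine ⟨polarFun (polarFun (steinerFun i G')), measurable_polarFun _, ?_, ?_, ?_, ?_⟩
      · have := hinv (-1) (by simp) (steinerFun_mul_sign i (by simp) (by simpa using hGe'))
        simpa using this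
      · intro j hj
        refine hinv _ (signFlip_mul_self j) ?_
        rcases Finset.mem_insert.1 hj with rfl | hj
        · exact steinerFun_signFlip _ _
        · exact steinerFun_mul_sign i (signFlip_mul_self j) (hGs' j hj)
      · exact (h1.trans (lintegral_polarFun_le_steinerFun i hGe')).trans
          (lintegral_mono fun x => le_polarFun_polarFun _ x)
      · exact h2.trans (lintegral_mul_le_steinerFun i hc hG' (measurable_polarFun _)
          (fun z => le_polarFun_polarFun _ z) hω hω0 (fun z => hωs z i))

theorem apply_abs_of_reflection_invariant {n : ℕ} {β : Type*} {G : (Fin n → ℝ) → β}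
    (h : ∀ i z, G (signFlip i * z) = G z) (z : Fin n → ℝ) :
    G (fun i => |z i|) = G z := by
  have key : ∀ S : Finset (Fin n), G (fun i => if i ∈ S then |z i| else z i) = G z := by
    intro S
    induction S using Finset.induction_on with
    | empty => simp
    | insert i S hi ih =>
      rw [← ih]
      rcases abs_choice (z i) with hz | hz
      · congr 1
        ext j
        by_cases hj : j = i
        · subst hj; simp [hi, hz]
        · simp [hj]
      · rw [← h i (fun j => if j ∈ S then |z j| else z j)]
        congr 1
        ext j
        by_cases hj : j = i
        · subst hj; simp [hi, hz, signFlip]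
        · simp [hj, signFlip]
  simpa using key Finset.univ

theorem blaschkeSantalo_of_even {n : ℕ} {p : ℝ} (hp : 1 < p) {v : (Fin n → ℝ) → ℝ}
    (hv : Measurable v) (hvu : ∀ x, v (fun i => |x i|) = v x)
    {D : (Fin n → ℝ) → (Fin n → ℝ)} (hD : Measurable D)
    (hDu : ∀ y i, |D (fun j => |y j|) i| = |D y i|)
    (H : ∀ x y, (∀ i, 0 < x i) → (∀ i, 0 < y i) →
      v (fun i => x i ^ (1 / p) * y i ^ (1 - 1 / p)) ≤ (x ⬝ᵥ D y) / p)
    {ω : (Fin n → ℝ) → ℝ} (hω : Measurable ω) (hω0 : ∀ z, 0 ≤ ω z)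
    (hωs : ∀ z i t, t ≠ 0 → |t| ≤ |z i| → ω z ≤ ω (Function.update z i t))
    (hωD : ∀ g : (Fin n → ℝ) → ℝ≥0∞, Measurable g →
      ∫⁻ y, g (D y) = ∫⁻ z, g z * ENNReal.ofReal (ω z))
    {G : (Fin n → ℝ) → ℝ≥0∞} (hG : Measurable G) (hGe : ∀ z, G (-z) = G z) :
    (∫⁻ x, polarFun G x) * (∫⁻ y, G (D y) ^ (1 / (p - 1))) ^ (p - 1) ≤
      (∫⁻ x, ENNReal.ofReal (Real.exp (-v x))) ^ p := by
  have hp1 : 0 < p - 1 := by linarith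
  obtain ⟨G', hG', -, hGs, h1, h2⟩ := exists_symmetrization (c := 1 / (p - 1)) (by positivity)
    hω hω0 hωs hG hGe Finset.univ
  have hu : ∀ z, G' (fun i => |z i|) = G' z :=
    apply_abs_of_reflection_invariant fun i => hGs i (Finset.mem_univ i)
  refine le_trans ?_ (blaschkeSantalo_of_unconditional hp hv hvu hD H (measurable_polarFun G') hG'
    (apply_abs_of_reflection_invariant fun i =>
      polarFun_mul_sign (signFlip_mul_self i) (hGs i (Finset.mem_univ i)))
    (fun y => by rw [← hu, ← hu (D y)]; simp only [hDu]) (polarFun_mul_le G'))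
  have e : ∀ G : (Fin n → ℝ) → ℝ≥0∞, Measurable G → ∫⁻ y, G (D y) ^ (1 / (p - 1)) =
      ∫⁻ z, G z ^ (1 / (p - 1)) * ENNReal.ofReal (ω z) :=
    fun G hG => hωD _ (hG.pow_const _)
  rw [e G hG, e G' hG']
  gcongr

/-! ### Growth of homogeneous convex functions. -/

section Homogeneous

variable {E : Type*} [NormedAddCommGroup E] [InnerProductSpace ℝ E] {p : ℝ} {V : E → ℝ}

theorem homogeneous_zero (hp : 1 < p) (hV : ∀ c : ℝ, 0 < c → ∀ x, V (c • x) = c ^ p * V x) :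
    V 0 = 0 := by
  have h := hV 2 (by norm_num) 0
  rw [smul_zero] at h
  have h2 : (1 : ℝ) < 2 ^ p := Real.one_lt_rpow (by norm_num) (by linarith)
  have h3 : ((2 : ℝ) ^ p - 1) * V 0 = 0 := by linarith
  rcases mul_eq_zero.1 h3 with h | h
  · linarith
  · exact h

/-- Strict convexity is used at 0, the midpoint of x and -x. -/
theorem homogeneous_pos (hp : 1 < p) (heven : ∀ x, V (-x) = V x)
    (hconv : StrictConvexOn ℝ univ V)
    (hV : ∀ c : ℝ, 0 < c → ∀ x, V (c • x) = c ^ p * V x) {x : E} (hx : x ≠ 0) : 0 < V x := by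
  have hne : x ≠ -x := fun h => hx (by
    have : (2 : ℝ) • x = 0 := by
      rw [two_smul]
      nth_rw 1 [h]
      exact neg_add_cancel x
    simpa using this)
  have h2 := hconv.2 (mem_univ x) (mem_univ (-x)) hne (by norm_num : (0 : ℝ) < 1 / 2)
    (by norm_num : (0 : ℝ) < 1 / 2) (by norm_num)
  simp only [smul_neg, add_neg_cancel, heven, smul_eq_mul] at h2
  rw [homogeneous_zero hp hV] at h2
  linarith

theorem exists_mul_norm_rpow_le [FiniteDimensional ℝ E] (hp : 1 < p) (heven : ∀ x, V (-x) = V x)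
    (hconv : StrictConvexOn ℝ univ V)
    (hV : ∀ c : ℝ, 0 < c → ∀ x, V (c • x) = c ^ p * V x) (hc : Continuous V) :
    ∃ m > 0, ∀ x, m * ‖x‖ ^ p ≤ V x := by
  have h0 : V 0 = 0 := homogeneous_zero hp hV
  rcases (Metric.sphere (0 : E) 1).eq_empty_or_nonempty with he | hne
  · refine ⟨1, one_pos, fun x => ?_⟩
    have : x = 0 := by
      by_contra hx
      have : ‖x‖⁻¹ • x ∈ Metric.sphere (0 : E) 1 := by simp [norm_smul, hx]
      rw [he] at this
      exact this
    rw [this, h0, norm_zero, Real.zero_rpow (by linarith), mul_zero]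
  · obtain ⟨x₀, hx₀, hmin⟩ := (isCompact_sphere (0 : E) 1).exists_isMinOn hne hc.continuousOn
    refine ⟨V x₀, homogeneous_pos hp heven hconv hV fun h => ?_, fun x => ?_⟩
    · simp [h] at hx₀
    · by_cases hx : x = 0
      · rw [hx, h0, norm_zero, Real.zero_rpow (by linarith), mul_zero]
      have hn : 0 < ‖x‖ := norm_pos_iff.2 hx
      have h1 : V x₀ ≤ V (‖x‖⁻¹ • x) := hmin (by simp [norm_smul, hx])
      have h2 := hV ‖x‖ hn (‖x‖⁻¹ • x)
      rw [smul_inv_smul₀ hn.ne'] at h2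
      rw [h2, mul_comm]
      gcongr

end Homogeneous

/-! ### The gradient as a homeomorphism. -/

section Gradient

variable {E : Type*} [NormedAddCommGroup E] [InnerProductSpace ℝ E] [CompleteSpace E]

theorem inner_gradient_eq_fderiv (f : E → ℝ) (x v : E) :
    inner ℝ (∇ f x) v = fderiv ℝ f x v :=
  InnerProductSpace.toDual_symm_apply

theorem gradient_eq_of_inner {f : E → ℝ} {x y : E} (h : ∀ v, fderiv ℝ f x v = inner ℝ y v) :
    ∇ f x = y :=
  ext_inner_right ℝ fun v => by rw [inner_gradient_eq_fderiv, h]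

theorem gradient_map_of_comp_eq {f : E → ℝ} (R : E ≃ₗᵢ[ℝ] E) (h : ∀ x, f (R x) = f x) (x : E) :
    ∇ f (R x) = R (∇ f x) := by
  refine gradient_eq_of_inner fun v => ?_
  have h1 : f ∘ R = f := funext h
  have h2 := R.toContinuousLinearEquiv.comp_right_fderiv (f := f) (x := x)
  have h3 : fderiv ℝ f x (R.symm v) = fderiv ℝ f (R x) v := by
    conv_lhs => rw [← h1]
    change fderiv ℝ (f ∘ R.toContinuousLinearEquiv) x (R.symm v) = _
    rw [h2]
    simp
  rw [← h3, ← inner_gradient_eq_fderiv, ← R.inner_map_map, R.apply_symm_apply]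

theorem hasDerivAt_comp_add_smul {f : E → ℝ} {x : E} (hf : DifferentiableAt ℝ f x) (v : E) :
    HasDerivAt (fun t : ℝ => f (x + t • v)) (inner ℝ (∇ f x) v) 0 := by
  rw [inner_gradient_eq_fderiv]
  have h1 : HasDerivAt (fun t : ℝ => x + t • v) v 0 := by
    simpa using ((hasDerivAt_id (0 : ℝ)).smul_const v).const_add x
  have h2 : HasFDerivAt f (fderiv ℝ f x) (x + (0 : ℝ) • v) := by simpa using hf.hasFDerivAt
  exact h2.comp_hasDerivAt 0 h1

theorem inner_gradient_le_sub {f : E → ℝ} (hf : ConvexOn ℝ univ f) {x : E}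
    (hd : DifferentiableAt ℝ f x) (y : E) : inner ℝ (∇ f x) (y - x) ≤ f y - f x := by
  have h := (hasDerivAt_comp_add_smul hd (y - x)).tendsto_slope_zero_right
  refine le_of_tendsto h ?_
  filter_upwards [Ioo_mem_nhdsGT (zero_lt_one' ℝ)] with t ht
  have := hf.2 (mem_univ x) (mem_univ y) (sub_nonneg.2 ht.2.le) ht.1.le (by ring)
  have e : (1 - t) • x + t • y = x + t • (y - x) := by module
  rw [e] at this
  simp only [zero_add, zero_smul, add_zero, smul_eq_mul] at this ⊢
  rw [inv_mul_le_iff₀ ht.1]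
  linarith

theorem inner_gradient_lt_sub {f : E → ℝ} (hf : StrictConvexOn ℝ univ f) {x y : E}
    (hd : DifferentiableAt ℝ f x) (hxy : x ≠ y) : inner ℝ (∇ f x) (y - x) < f y - f x := by
  have h1 := inner_gradient_le_sub hf.convexOn hd ((1 / 2 : ℝ) • x + (1 / 2 : ℝ) • y)
  have h2 := hf.2 (mem_univ x) (mem_univ y) hxy (by norm_num : (0 : ℝ) < 1 / 2)
    (by norm_num : (0 : ℝ) < 1 / 2) (by norm_num)
  have e : (1 / 2 : ℝ) • x + (1 / 2 : ℝ) • y - x = (1 / 2 : ℝ) • (y - x) := by module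
  rw [e, inner_smul_right] at h1
  simp only [smul_eq_mul] at h2
  linarith

theorem gradient_injective {f : E → ℝ} (hf : StrictConvexOn ℝ univ f) (hd : Differentiable ℝ f) :
    Function.Injective (∇ f) := by
  intro x y hxy
  by_contra hne
  have h1 := inner_gradient_lt_sub hf (hd x) hne
  have h2 := inner_gradient_lt_sub hf (hd y) (Ne.symm hne)
  rw [← hxy, ← neg_sub y x, inner_neg_right] at h2
  linarith

theorem gradient_monotone {f : E → ℝ} (hf : ConvexOn ℝ univ f) (hd : Differentiable ℝ f)
    (x y : E) : 0 ≤ inner ℝ (∇ f y - ∇ f x) (y - x) := by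
  have h1 := inner_gradient_le_sub hf (hd x) y
  have h2 := inner_gradient_le_sub hf (hd y) x
  rw [← neg_sub y x, inner_neg_right] at h2
  rw [inner_sub_left]
  linarith

theorem ContDiff.continuous_gradient {f : E → ℝ} (hf : ContDiff ℝ 1 f) : Continuous (∇ f) :=
  (InnerProductSpace.toDual ℝ E).symm.continuous.comp (hf.continuous_fderiv (by norm_num))

variable {p : ℝ} {V : E → ℝ}

/-- The Euler identity for homogeneous functions. -/
theorem inner_gradient_self (hV : ∀ c : ℝ, 0 < c → ∀ x, V (c • x) = c ^ p * V x) {x : E}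
    (hd : DifferentiableAt ℝ V x) : inner ℝ (∇ V x) x = p * V x := by
  have h1 := hasDerivAt_comp_add_smul hd x
  have h2 : HasDerivAt (fun t : ℝ => (1 + t) ^ p * V x) (p * V x) 0 := by
    have : HasDerivAt (fun t : ℝ => 1 + t) 1 0 := by simpa using (hasDerivAt_id (0 : ℝ)).const_add 1
    simpa using (this.rpow_const (p := p) (Or.inl (by norm_num))).mul_const (V x)
  refine h1.unique (h2.congr_of_eventuallyEq ?_)
  filter_upwards [Ioi_mem_nhds (show (-1 : ℝ) < 0 by norm_num)] with t ht
  rw [mem_Ioi] at ht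
  rw [← hV (1 + t) (by linarith), add_smul, one_smul]

-- Euler's identity gives pm‖x‖^p ≤ pV(x) = ⟨∇V(x), x⟩ ≤ ‖∇V(x)‖‖x‖. The resulting properness makes
-- the inverse of ∇V continuous.
open Filter Topology in
theorem tendsto_norm_gradient [FiniteDimensional ℝ E] (hp : 1 < p) (heven : ∀ x, V (-x) = V x)
    (hconv : StrictConvexOn ℝ univ V)
    (hV : ∀ c : ℝ, 0 < c → ∀ x, V (c • x) = c ^ p * V x) (hd : Differentiable ℝ V) :
    Tendsto (∇ V) (cocompact E) (cocompact E) := by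
  obtain ⟨m, hm, hmV⟩ := exists_mul_norm_rpow_le hp heven hconv hV hd.continuous
  rw [← Metric.cobounded_eq_cocompact, ← tendsto_norm_atTop_iff_cobounded]
  have h1 : Tendsto (fun x : E => p * m * ‖x‖ ^ (p - 1)) (Bornology.cobounded E) atTop :=
    ((tendsto_rpow_atTop (by linarith : 0 < p - 1)).comp tendsto_norm_cobounded_atTop).const_mul_atTop
      (by positivity)
  refine tendsto_atTop_mono' _ ?_ h1
  have h0 : ∀ᶠ x : E in Bornology.cobounded E, 0 < ‖x‖ :=
    tendsto_norm_cobounded_atTop.eventually_gt_atTop 0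
  filter_upwards [h0] with x hx
  have h2 := real_inner_le_norm (∇ V x) x
  rw [inner_gradient_self hV (hd x)] at h2
  have h3 : p * m * ‖x‖ ^ (p - 1) * ‖x‖ ≤ ‖∇ V x‖ * ‖x‖ := by
    have : ‖x‖ ^ (p - 1) * ‖x‖ = ‖x‖ ^ p := by
      rw [← Real.rpow_add_one hx.ne', sub_add_cancel]
    rw [mul_assoc, this]
    refine le_trans ?_ h2
    rw [mul_assoc]
    exact mul_le_mul_of_nonneg_left (hmV x) (by linarith)
  exact le_of_mul_le_mul_right h3 hx

-- By superlinear growth V - ⟨y, ·⟩ attains its minimum, and at a minimizer ∇V = y.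
open Filter Topology in
theorem gradient_surjective [FiniteDimensional ℝ E] (hp : 1 < p) (heven : ∀ x, V (-x) = V x)
    (hconv : StrictConvexOn ℝ univ V)
    (hV : ∀ c : ℝ, 0 < c → ∀ x, V (c • x) = c ^ p * V x) (hd : Differentiable ℝ V) :
    Function.Surjective (∇ V) := by
  intro y
  obtain ⟨m, hm, hmV⟩ := exists_mul_norm_rpow_le hp heven hconv hV hd.continuous
  have hcont : Continuous fun x => V x - inner ℝ y x := hd.continuous.sub (by fun_prop)
  have hlim : Tendsto (fun x => V x - inner ℝ y x) (cocompact E) atTop := by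
    rw [← Metric.cobounded_eq_cocompact]
    have h1 : Tendsto (fun r : ℝ => r * (m * r ^ (p - 1) + -‖y‖)) atTop atTop :=
      tendsto_id.atTop_mul_atTop₀ (tendsto_atTop_add_const_right _ _
        ((tendsto_rpow_atTop (by linarith : 0 < p - 1)).const_mul_atTop hm))
    refine tendsto_atTop_mono' _ ?_ (h1.comp tendsto_norm_cobounded_atTop)
    have h0 : ∀ᶠ x : E in Bornology.cobounded E, 0 < ‖x‖ :=
      tendsto_norm_cobounded_atTop.eventually_gt_atTop 0
    filter_upwards [h0] with x hx
    have h2 := real_inner_le_norm y x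
    have h3 : ‖x‖ ^ (p - 1) * ‖x‖ = ‖x‖ ^ p := by
      rw [← Real.rpow_add_one hx.ne', sub_add_cancel]
    have h4 := hmV x
    rw [← h3] at h4
    simp only [Function.comp]
    nlinarith
  obtain ⟨x, hx⟩ := hcont.exists_forall_le hlim
  refine ⟨x, gradient_eq_of_inner fun v => ?_⟩
  have hmin : IsLocalMin (fun x => V x - inner ℝ y x) x := Filter.Eventually.of_forall hx
  have h1 := hmin.fderiv_eq_zero
  have h2 : HasFDerivAt (fun x => V x - inner ℝ y x) (fderiv ℝ V x - innerSL ℝ y) x :=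
    (hd x).hasFDerivAt.sub (innerSL ℝ y).hasFDerivAt
  rw [h2.fderiv] at h1
  have := congrArg (fun L : E →L[ℝ] ℝ => L v) h1
  simp only [sub_apply, innerSL_apply_apply, zero_apply] at this
  linarith

/-- The gradient of a strictly convex even homogeneous `C¹` function is a homeomorphism. -/
noncomputable def gradientHomeomorph [FiniteDimensional ℝ E] (hp : 1 < p) (heven : ∀ x, V (-x) = V x)
    (hconv : StrictConvexOn ℝ univ V)
    (hV : ∀ c : ℝ, 0 < c → ∀ x, V (c • x) = c ^ p * V x) (hC : ContDiff ℝ 1 V) : E ≃ₜ E :=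
  (Equiv.ofBijective (∇ V) ⟨gradient_injective hconv (hC.differentiable (by norm_num)),
    gradient_surjective hp heven hconv hV (hC.differentiable (by norm_num))⟩).toHomeomorphOfContinuousClosed
    hC.continuous_gradient
    (isProperMap_iff_tendsto_cocompact.2 ⟨hC.continuous_gradient,
      tendsto_norm_gradient hp heven hconv hV (hC.differentiable (by norm_num))⟩).isClosedMap

end Gradient

/-! ### The gradient of the Legendre transform. -/

section Legendre

variable {n : ℕ} {V : EuclideanSpace ℝ (Fin n) → ℝ}

theorem legendreReal_gradient (hconv : ConvexOn ℝ univ V) (hd : Differentiable ℝ V)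
    (x : EuclideanSpace ℝ (Fin n)) :
    legendreReal V (∇ V x) = inner ℝ x (∇ V x) - V x := by
  have : legendre (fun x => (V x : EReal)) (∇ V x) = ((inner ℝ x (∇ V x) - V x : ℝ) : EReal) := by
    refine le_antisymm (iSup_le fun y => ?_) ?_
    · rw [← EReal.coe_sub, EReal.coe_le_coe_iff]
      have := inner_gradient_le_sub hconv (hd x) y
      rw [inner_sub_right, real_inner_comm, real_inner_comm x] at this
      linarith
    · rw [EReal.coe_sub]
      exact le_iSup (fun y => ((inner ℝ y (∇ V x) : ℝ) : EReal) - (V y : EReal)) x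
  rw [legendreReal, this, EReal.toReal_coe]

/-- With T inverse to ∇V, Fenchel's inequality gives ⟨T z, w - z⟩ ≤ V*(w) - V*(z) ≤ ⟨T w, w - z⟩.
The bounds differ by at most ‖T w - T z‖‖w - z‖ = o(‖w - z‖). -/
theorem hasGradientAt_legendreReal (hconv : ConvexOn ℝ univ V) (hd : Differentiable ℝ V)
    {T : EuclideanSpace ℝ (Fin n) → EuclideanSpace ℝ (Fin n)} (hT : Continuous T)
    (hVT : ∀ z, ∇ V (T z) = z) (z : EuclideanSpace ℝ (Fin n)) :
    HasGradientAt (legendreReal V) (T z) z := by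
  have hval : ∀ w, legendreReal V w = inner ℝ (T w) w - V (T w) := fun w => by
    have := legendreReal_gradient hconv hd (T w)
    rwa [hVT] at this
  have hle : ∀ w x, inner ℝ x w - V x ≤ legendreReal V w := fun w x => by
    have := inner_gradient_le_sub hconv (hd (T w)) x
    rw [hVT, inner_sub_right, real_inner_comm, real_inner_comm (T w)] at this
    rw [hval]
    linarith
  rw [hasGradientAt_iff_isLittleO]
  have hTo : (fun w => ‖T w - T z‖ * ‖w - z‖) =o[nhds z] fun w => w - z := by
    refine (Asymptotics.isLittleO_norm_right).1 ?_
    have h1 : (fun w => ‖T w - T z‖) =o[nhds z] fun _ => (1 : ℝ) := by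
      rw [Asymptotics.isLittleO_one_iff]
      have := ((hT.sub continuous_const).norm (E := EuclideanSpace ℝ (Fin n))).tendsto (x := z)
        (f := fun w => ‖T w - T z‖)
      simpa using this
    simpa using h1.mul_isBigO (Asymptotics.isBigO_refl (fun w => ‖w - z‖) (nhds z))
  refine Asymptotics.IsBigO.trans_isLittleO (Asymptotics.isBigO_of_le _ fun w => ?_) hTo
  have h1 := hle w (T z)
  have h2 := hle z (T w)
  have h3 := real_inner_le_norm (T w - T z) (w - z)
  rw [inner_sub_left] at h3
  have e1 : inner ℝ (T z) (w - z) = inner ℝ (T z) w - inner ℝ (T z) z := inner_sub_right _ _ _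
  have e2 : inner ℝ (T w) (w - z) = inner ℝ (T w) w - inner ℝ (T w) z := inner_sub_right _ _ _
  rw [hval w, hval z] at *
  rw [Real.norm_eq_abs, Real.norm_of_nonneg (by positivity : 0 ≤ ‖T w - T z‖ * ‖w - z‖), abs_le]
  constructor
  · have : 0 ≤ ‖T w - T z‖ * ‖w - z‖ := by positivity
    linarith
  · linarith

end Legendre

/-! ### Jacobians of monotone and of equivariant maps. -/

/-- Along the segment from the identity to A all operators before the endpoint have positive
definite quadratic form, so the determinant cannot cross 0. -/
theorem det_nonneg_of_inner_nonneg {E : Type*} [NormedAddCommGroup E] [InnerProductSpace ℝ E]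
    [FiniteDimensional ℝ E] (A : E →L[ℝ] E) (hA : ∀ v, 0 ≤ inner ℝ (A v) v) : 0 ≤ A.det := by
  by_contra! hneg
  let B : ℝ → E →L[ℝ] E := fun s => s • A + (1 - s) • ContinuousLinearMap.id ℝ E
  have hB : Continuous fun s => (B s).det :=
    ContinuousLinearMap.continuous_det.comp (by fun_prop)
  have h0 : (B 0).det = 1 := by simp [B, ContinuousLinearMap.det]
  have h1 : (B 1).det = A.det := by simp [B]
  obtain ⟨s, hs, hs0⟩ := intermediate_value_Icc' (zero_le_one' ℝ) hB.continuousOn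
    (show (0 : ℝ) ∈ Icc ((B 1).det) ((B 0).det) by rw [h0, h1]; exact ⟨hneg.le, zero_le_one⟩)
  have hs1 : s < 1 := lt_of_le_of_ne hs.2 (by rintro rfl; linarith)
  have hker := LinearMap.bot_lt_ker_of_det_eq_zero (f := (B s : E →ₗ[ℝ] E)) hs0
  obtain ⟨v, hv, hv0⟩ := (Submodule.ne_bot_iff _).1 hker.ne'
  have hv' : B s v = 0 := hv
  have h2 : inner ℝ (B s v) v = s * inner ℝ (A v) v + (1 - s) * ‖v‖ ^ 2 := by
    simp [B, inner_add_left, inner_smul_left]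
  rw [hv', inner_zero_left] at h2
  have h3 : 0 < ‖v‖ ^ 2 := by positivity
  nlinarith [mul_nonneg hs.1 (hA v), mul_pos (sub_pos.2 hs1) h3]

theorem det_fderiv_nonneg_of_monotone {E : Type*} [NormedAddCommGroup E] [InnerProductSpace ℝ E]
    [FiniteDimensional ℝ E] {f : E → E} (hf : ∀ x y, 0 ≤ inner ℝ (f y - f x) (y - x)) {x : E}
    (hd : DifferentiableAt ℝ f x) : 0 ≤ (fderiv ℝ f x).det := by
  refine det_nonneg_of_inner_nonneg _ fun v => ?_
  have h1 : HasDerivAt (fun t : ℝ => f (x + t • v)) (fderiv ℝ f x v) 0 := by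
    have h1 : HasDerivAt (fun t : ℝ => x + t • v) v 0 := by
      simpa using ((hasDerivAt_id (0 : ℝ)).smul_const v).const_add x
    have h2 : HasFDerivAt f (fderiv ℝ f x) (x + (0 : ℝ) • v) := by simpa using hd.hasFDerivAt
    exact h2.comp_hasDerivAt 0 h1
  have h2 := Filter.Tendsto.inner (𝕜 := ℝ) h1.tendsto_slope_zero_right (tendsto_const_nhds (x := v))
  refine ge_of_tendsto h2 ?_
  filter_upwards [self_mem_nhdsWithin] with t ht
  rw [mem_Ioi] at ht
  simp only [zero_add, zero_smul, add_zero]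
  have h3 := hf x (x + t • v)
  rw [add_sub_cancel_left, inner_smul_right] at h3
  rw [inner_smul_left]
  exact mul_nonneg (by simpa using ht.le) (nonneg_of_mul_nonneg_right h3 ht)

theorem det_fderiv_map_of_comm {E : Type*} [NormedAddCommGroup E] [NormedSpace ℝ E]
    {f : E → E} (R : E ≃L[ℝ] E) (h : ∀ x, f (R x) = R (f x)) (x : E) :
    (fderiv ℝ f (R x)).det = (fderiv ℝ f x).det := by
  have h1 : f ∘ R = R ∘ f := funext h
  have h2 : (fderiv ℝ f (R x)).comp (R : E →L[ℝ] E) = (R : E →L[ℝ] E).comp (fderiv ℝ f x) := by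
    rw [← R.comp_right_fderiv, h1, R.comp_fderiv]
  have h3 : fderiv ℝ f (R x) =
      ((R : E →L[ℝ] E).comp (fderiv ℝ f x)).comp (R.symm : E →L[ℝ] E) := by
    rw [← h2]
    ext v
    simp
  rw [h3]
  exact LinearMap.det_conj (fderiv ℝ f x : E →ₗ[ℝ] E) R.toLinearEquiv

/-! ### Coordinate reflections. -/

/-- The reflection of the `i`-th coordinate. -/
noncomputable def coordReflection {n : ℕ} (i : Fin n) :
    EuclideanSpace ℝ (Fin n) ≃ₗᵢ[ℝ] EuclideanSpace ℝ (Fin n) :=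
  LinearIsometryEquiv.piLpCongrRight 2 fun j =>
    if j = i then LinearIsometryEquiv.neg ℝ else LinearIsometryEquiv.refl ℝ ℝ

theorem ofLp_coordReflection {n : ℕ} (i : Fin n) (x : EuclideanSpace ℝ (Fin n)) :
    WithLp.ofLp (coordReflection i x) = signFlip i * WithLp.ofLp x := by
  ext j
  by_cases hj : j = i
  · subst hj
    simp [coordReflection, signFlip]
  · simp [coordReflection, signFlip, hj]

theorem toLp_signFlip_mul {n : ℕ} (i : Fin n) (x : Fin n → ℝ) :
    WithLp.toLp 2 (signFlip i * x) = coordReflection i (WithLp.toLp 2 x) := by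
  apply WithLp.ofLp_injective
  rw [ofLp_coordReflection]

theorem coordReflection_eq_self_iff {n : ℕ} {i : Fin n} {x : EuclideanSpace ℝ (Fin n)} :
    coordReflection i x = x ↔ x i = 0 := by
  constructor
  · intro h
    have := congrFun (congrArg WithLp.ofLp h) i
    rw [ofLp_coordReflection] at this
    simp only [signFlip, Pi.mul_apply, Function.update_self] at this
    linarith
  · intro h
    apply WithLp.ofLp_injective
    rw [ofLp_coordReflection]
    ext j
    by_cases hj : j = i
    · subst hj; simp [h]
    · simp [signFlip, hj]

theorem IsUnconditional.comp_coordReflection {n : ℕ} {β : Type*}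
    {f : EuclideanSpace ℝ (Fin n) → β} (hf : IsUnconditional f) (i : Fin n)
    (x : EuclideanSpace ℝ (Fin n)) : f (coordReflection i x) = f x := by
  refine hf _ _ fun j => ?_
  rw [ofLp_coordReflection]
  by_cases hj : j = i
  · subst hj; simp [signFlip]
  · simp [signFlip, hj]

/-! ### The tangent inequality at geometric means. -/

/-- For the concave W(w) = V(w^{1/p}), the tangent at v = y^p is evaluated at u = x y^{p-1}, so that
W(v) = V(y) and W(u) is the left side; Euler's identity cancels V(y). -/
theorem apply_geomMean_le {n : ℕ} {p : ℝ} (hp : 1 < p) {V : EuclideanSpace ℝ (Fin n) → ℝ}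
    (hV_hom : ∀ c : ℝ, 0 < c → ∀ x, V (c • x) = c ^ p * V x) (hd : Differentiable ℝ V)
    (hV_conc : ConcaveOn ℝ {x : EuclideanSpace ℝ (Fin n) | ∀ i, 0 ≤ x i}
      (fun x => V (WithLp.toLp 2 (fun i => x i ^ (1 / p)))))
    (x y : Fin n → ℝ) (hx : ∀ i, 0 < x i) (hy : ∀ i, 0 < y i) :
    V (WithLp.toLp 2 fun i => x i ^ (1 / p) * y i ^ (1 - 1 / p)) ≤
      (x ⬝ᵥ WithLp.ofLp (∇ V (WithLp.toLp 2 y))) / p := by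
  have hp0 : 0 < p := by linarith
  set u : Fin n → ℝ := fun i => x i * y i ^ (p - 1) with hu
  set v : Fin n → ℝ := fun i => y i ^ p with hv
  have hu0 : ∀ i, 0 < u i := fun i => mul_pos (hx i) (Real.rpow_pos_of_pos (hy i) _)
  have hv0 : ∀ i, 0 < v i := fun i => Real.rpow_pos_of_pos (hy i) _
  have hup : (fun i => u i ^ (1 / p)) = fun i => x i ^ (1 / p) * y i ^ (1 - 1 / p) := by
    ext i
    rw [hu, Real.mul_rpow (hx i).le (Real.rpow_nonneg (hy i).le _), ← Real.rpow_mul (hy i).le]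
    congr 2
    field_simp
  have hvp : (fun i => v i ^ (1 / p)) = y := by
    ext i
    rw [hv, ← Real.rpow_mul (hy i).le, mul_one_div_cancel hp0.ne', Real.rpow_one]
  -- The p-th root of the segment from v to u starts at y with velocity (x - y)/p.
  let c : ℝ → Fin n → ℝ := fun t i => (v i + t * (u i - v i)) ^ (1 / p)
  have hc : HasDerivAt c (fun i => (x i - y i) / p) 0 := by
    refine hasDerivAt_pi.2 fun i => ?_
    have h1 : HasDerivAt (fun t : ℝ => v i + t * (u i - v i)) (u i - v i) 0 := by
      simpa using ((hasDerivAt_id (0 : ℝ)).mul_const (u i - v i)).const_add (v i)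
    have h2 := h1.rpow_const (p := 1 / p) (Or.inl (by simpa using (hv0 i).ne'))
    refine h2.congr_deriv (Eq.symm ?_)
    change (x i - y i) / p = (x i * y i ^ (p - 1) - y i ^ p) * (1 / p) *
      (y i ^ p + 0 * (u i - v i)) ^ (1 / p - 1)
    rw [zero_mul, add_zero, ← Real.rpow_mul (hy i).le]
    have e1 : y i ^ (p * (1 / p - 1)) * y i ^ (p - 1) = 1 := by
      rw [← Real.rpow_add (hy i)]
      have : p * (1 / p - 1) + (p - 1) = 0 := by field_simp; ring
      rw [this, Real.rpow_zero]
    have e2 : y i ^ p = y i ^ (p - 1) * y i := by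
      rw [← Real.rpow_add_one (hy i).ne', sub_add_cancel]
    rw [e2]
    linear_combination (-(x i - y i) / p) * e1
  have hc0 : c 0 = y := by
    rw [← hvp]
    ext i
    simp [c]
  have hφ : HasDerivAt (fun t => V (WithLp.toLp 2 (c t)))
      (fderiv ℝ V (WithLp.toLp 2 y) (WithLp.toLp 2 fun i => (x i - y i) / p)) 0 := by
    have h1 : HasDerivAt (fun t => WithLp.toLp 2 (c t)) (WithLp.toLp 2 fun i => (x i - y i) / p) 0 :=
      ((PiLp.continuousLinearEquiv 2 ℝ fun _ : Fin n => ℝ).symm :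
        (Fin n → ℝ) →L[ℝ] EuclideanSpace ℝ (Fin n)).hasFDerivAt.comp_hasDerivAt 0 hc
    have h2 : HasFDerivAt V (fderiv ℝ V (WithLp.toLp 2 y)) (WithLp.toLp 2 (c 0)) := by
      rw [hc0]; exact (hd _).hasFDerivAt
    exact h2.comp_hasDerivAt 0 h1
  have hslope : V (WithLp.toLp 2 fun i => u i ^ (1 / p)) - V (WithLp.toLp 2 y) ≤
      fderiv ℝ V (WithLp.toLp 2 y) (WithLp.toLp 2 fun i => (x i - y i) / p) := by
    refine ge_of_tendsto hφ.tendsto_slope_zero_right ?_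
    filter_upwards [Ioo_mem_nhdsGT (zero_lt_one' ℝ)] with t ht
    have h1 := hV_conc.2 (x := WithLp.toLp 2 v) (fun i => (hv0 i).le) (y := WithLp.toLp 2 u)
      (fun i => (hu0 i).le) (sub_nonneg.2 ht.2.le) ht.1.le (by ring)
    have e : (fun i => (((1 - t) • WithLp.toLp 2 v + t • WithLp.toLp 2 u :
        EuclideanSpace ℝ (Fin n)) i) ^ (1 / p)) = c t := by
      ext i
      simp only [c, PiLp.add_apply, PiLp.smul_apply, smul_eq_mul]
      congr 1
      ring
    beta_reduce at h1
    rw [e, hvp] at h1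
    simp only [smul_eq_mul, zero_add, hc0] at h1 ⊢
    rw [le_inv_mul_iff₀ ht.1]
    linarith
  rw [hup, ← inner_gradient_eq_fderiv] at hslope
  have hE := inner_gradient_self hV_hom (hd (WithLp.toLp 2 y))
  have e1 : (WithLp.toLp 2 fun i => (x i - y i) / p : EuclideanSpace ℝ (Fin n)) =
      p⁻¹ • (WithLp.toLp 2 x - WithLp.toLp 2 y) := by
    ext i
    simp
    ring
  have e2 : inner ℝ (∇ V (WithLp.toLp 2 y)) (WithLp.toLp 2 x) =
      x ⬝ᵥ WithLp.ofLp (∇ V (WithLp.toLp 2 y)) := by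
    rw [EuclideanSpace.inner_eq_star_dotProduct]
    simp
  rw [e1, inner_smul_right, inner_sub_right, hE, e2] at hslope
  rw [div_eq_inv_mul (x ⬝ᵥ _)]
  have e3 : p⁻¹ * (p * V (WithLp.toLp 2 y)) = V (WithLp.toLp 2 y) := by
    rw [inv_mul_cancel_left₀ hp0.ne']
  rw [mul_sub, e3] at hslope
  linarith

/-! ### Nonvanishing of a function with decreasing reciprocal. -/

/-- The point with coordinates from the second vector on `S` and from the first one off `S`. -/
def mixCoord {n : ℕ} (S : Finset (Fin n)) : (Fin n → ℝ) × (Fin n → ℝ) →ₗ[ℝ] (Fin n → ℝ) where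
  toFun q i := if i ∈ S then q.2 i else q.1 i
  map_add' q r := by
    ext i
    by_cases h : i ∈ S <;> simp [h]
  map_smul' c q := by
    ext i
    by_cases h : i ∈ S <;> simp [h]

theorem mixCoord_insert {n : ℕ} (i : Fin n) (S : Finset (Fin n)) (q : (Fin n → ℝ) × (Fin n → ℝ)) :
    mixCoord (insert i S) q = Function.update (mixCoord S q) i (q.2 i) := by
  ext j
  by_cases hj : j = i
  · subst hj; simp [mixCoord]
  · simp [mixCoord, hj]

/-- A function whose inverse decreases along the coordinate lines on a dense open set does not
vanish on the positive orthant. -/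
theorem ne_zero_of_inv_antitone {n : ℕ} {δ : (Fin n → ℝ) → ℝ} {A : Set (Fin n → ℝ)}
    (hopen : IsOpen A) (hdense : Dense A) (hcont : ∀ z, (∀ i, 0 < z i) → ContinuousAt δ z)
    (hpos : ∀ z ∈ A, 0 < δ z)
    (hanti : ∀ z ∈ A, ∀ i t, Function.update z i t ∈ A → 0 < z i → z i ≤ t →
      (δ (Function.update z i t))⁻¹ ≤ (δ z)⁻¹) (z : Fin n → ℝ) (hz : ∀ i, 0 < z i) :
    δ z ≠ 0 := by
  intro h0
  -- For a generic pair all points mixing its coordinates lie in A, so one can pass from q.1 to q.2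
  -- one coordinate at a time within A.
  have hmix : Dense (⋂ S : Finset (Fin n), mixCoord S ⁻¹' A) := by
    refine dense_iInter_of_isOpen (fun S => ?_) (fun S => ?_)
    · exact hopen.preimage (LinearMap.continuous_of_finiteDimensional _)
    · refine hdense.preimage (LinearMap.isOpenMap_of_finiteDimensional _ fun x => ⟨(x, x), ?_⟩)
      ext i
      simp [mixCoord]
  have hchain : ∀ q ∈ ⋂ S : Finset (Fin n), mixCoord S ⁻¹' A, (∀ i, 0 < q.1 i) →
      (∀ i, q.1 i ≤ q.2 i) → (δ q.2)⁻¹ ≤ (δ q.1)⁻¹ := by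
    intro q hq hq0 hq1
    have hqA : ∀ S, mixCoord S q ∈ A := fun S => mem_iInter.1 hq S
    have key : ∀ S : Finset (Fin n), (δ (mixCoord S q))⁻¹ ≤ (δ q.1)⁻¹ := by
      intro S
      induction S using Finset.induction_on with
      | empty =>
        have : mixCoord ∅ q = q.1 := by ext i; simp [mixCoord]
        rw [this]
      | insert i S hi ih =>
        have hmi : mixCoord S q i = q.1 i := by simp [mixCoord, hi]
        refine le_trans ?_ ih
        have h1 := hqA (insert i S)
        rw [mixCoord_insert] at h1 ⊢
        exact hanti _ (hqA S) i _ h1 (by rw [hmi]; exact hq0 i) (by rw [hmi]; exact hq1 i)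
    have : mixCoord Finset.univ q = q.2 := by ext i; simp [mixCoord]
    rw [← this]
    exact key _
  have hbox : IsOpen {u : Fin n → ℝ | ∀ i, 0 < u i ∧ u i < z i} := by
    simp only [ofPred_forall]
    refine isOpen_iInter_of_finite fun i => ?_
    exact (isOpen_lt continuous_const (continuous_apply i)).inter
      (isOpen_lt (continuous_apply i) continuous_const)
  obtain ⟨u, hu, huA⟩ := hdense.inter_open_nonempty _ hbox
    ⟨fun i => z i / 2, fun i => ⟨half_pos (hz i), half_lt_self (hz i)⟩⟩
  have hu' : ∀ i, 0 < u i ∧ u i < z i := hu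
  have hδu := hpos u huA
  set K := (δ u)⁻¹ + 1 with hK
  have hK0 : 0 < K := by positivity
  -- As 0⁻¹ = 0, no contradiction arises at z itself. A nearby q.2 in A has (δ q.2)⁻¹ > K, while
  -- q.1, near u and below q.2, has (δ q.1)⁻¹ < K.
  have hev : ∀ᶠ q in nhds (u, z), ((∀ i, 0 < q.1 i) ∧ (∀ i, q.1 i < q.2 i)) ∧
      ((δ q.1)⁻¹ < K ∧ δ q.2 < K⁻¹) := by
    refine Filter.Eventually.and ?_ (Filter.Eventually.and ?_ ?_)
    · have ho : IsOpen {q : (Fin n → ℝ) × (Fin n → ℝ) |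
          (∀ i, 0 < q.1 i) ∧ ∀ i, q.1 i < q.2 i} := by
        simp only [ofPred_and, ofPred_forall]
        refine IsOpen.inter (isOpen_iInter_of_finite fun i => ?_)
          (isOpen_iInter_of_finite fun i => ?_)
        · exact isOpen_lt continuous_const (by fun_prop)
        · exact isOpen_lt (by fun_prop) (by fun_prop)
      exact ho.mem_nhds ⟨fun i => (hu' i).1, fun i => (hu' i).2⟩
    · have h1 : ContinuousAt (fun q : (Fin n → ℝ) × (Fin n → ℝ) => (δ q.1)⁻¹) (u, z) :=
        (ContinuousAt.comp (f := Prod.fst) (x := (u, z)) (hcont u fun i => (hu' i).1)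
          continuousAt_fst).inv₀ hδu.ne'
      exact h1.eventually_lt continuousAt_const (by rw [hK]; simp)
    · have h1 : ContinuousAt (fun q : (Fin n → ℝ) × (Fin n → ℝ) => δ q.2) (u, z) :=
        ContinuousAt.comp (f := Prod.snd) (x := (u, z)) (hcont z hz) continuousAt_snd
      exact h1.eventually_lt continuousAt_const (by simpa [h0] using hK0)
  obtain ⟨q, hqm, hq⟩ := hmix.inter_nhds_nonempty hev
  obtain ⟨⟨hq1, hq2⟩, hq3, hq4⟩ := hq
  have h1 := hchain q hqm hq1 fun i => (hq2 i).le
  have hqA : q.2 ∈ A := by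
    have := mem_iInter.1 hqm Finset.univ
    have e : mixCoord Finset.univ q = q.2 := by ext i; simp [mixCoord]
    rwa [mem_preimage, e] at this
  have h2 := (lt_inv_comm₀ (hpos _ hqA) hK0).1 hq4
  linarith

/-! ### Lebesgue measure in coordinates and the coordinate hyperplanes. -/

theorem lintegral_euclideanSpace {n : ℕ} (f : EuclideanSpace ℝ (Fin n) → ℝ≥0∞) :
    ∫⁻ x, f x = ∫⁻ x : Fin n → ℝ, f (WithLp.toLp 2 x) :=
  ((PiLp.volume_preserving_toLp (Fin n)).lintegral_comp_emb
    (MeasurableEquiv.toLp 2 (Fin n → ℝ)).measurableEmbedding f).symm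

theorem ae_forall_coord_ne_zero (n : ℕ) :
    ∀ᵐ x : EuclideanSpace ℝ (Fin n), ∀ i, x i ≠ 0 := by
  have h : ∀ᵐ x : Fin n → ℝ, ∀ i, x i ≠ 0 :=
    ae_all_iff.2 fun i => Measure.ae_eval_ne _ i 0
  exact (PiLp.volume_preserving_ofLp (Fin n)).quasiMeasurePreserving.ae h

theorem isOpen_forall_coord_ne_zero (n : ℕ) :
    IsOpen {x : EuclideanSpace ℝ (Fin n) | ∀ i, x i ≠ 0} := by
  simp only [ofPred_forall]
  exact isOpen_iInter_of_finite fun i =>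
    isOpen_ne.preimage (by fun_prop : Continuous fun x : EuclideanSpace ℝ (Fin n) => x i)

theorem toLp_update_zero_add_smul_single {n : ℕ} (z : Fin n → ℝ) (i : Fin n) (t : ℝ) :
    (WithLp.toLp 2 (Function.update z i 0) + t • EuclideanSpace.single i (1 : ℝ) :
      EuclideanSpace ℝ (Fin n)) = WithLp.toLp 2 (Function.update z i t) := by
  ext j
  by_cases hj : j = i
  · subst hj; simp
  · simp [hj]

theorem apply_update_abs {n : ℕ} {β : Type*} {f : (Fin n → ℝ) → β} (i : Fin n)
    (h : ∀ z, f (signFlip i * z) = f z) (z : Fin n → ℝ) (t : ℝ) :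
    f (Function.update z i |t|) = f (Function.update z i t) := by
  rcases abs_choice t with ht | ht
  · rw [ht]
  · rw [ht, ← h (Function.update z i t)]
    congr 1
    ext j
    by_cases hj : j = i
    · subst hj; simp [signFlip]
    · simp [signFlip, hj]

/-! ### The density of the image of Lebesgue measure under the gradient. -/

section Density

variable {n : ℕ} {e : EuclideanSpace ℝ (Fin n) ≃ₜ EuclideanSpace ℝ (Fin n)}

/-- Each coordinate hyperplane is the fixed set of a reflection commuting with e. -/
theorem forall_coord_ne_zero_iff
    (hcomm : ∀ i x, e (coordReflection i x) = coordReflection i (e x))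
    (x : EuclideanSpace ℝ (Fin n)) : (∀ i, e x i ≠ 0) ↔ ∀ i, x i ≠ 0 := by
  refine forall_congr' fun i => not_congr ?_
  rw [← coordReflection_eq_self_iff, ← coordReflection_eq_self_iff, ← hcomm]
  exact e.injective.eq_iff

theorem symm_coordReflection (hcomm : ∀ i x, e (coordReflection i x) = coordReflection i (e x))
    (i : Fin n) (z : EuclideanSpace ℝ (Fin n)) :
    e.symm (coordReflection i z) = coordReflection i (e.symm z) := by
  rw [e.symm_apply_eq, hcomm, e.apply_symm_apply]

theorem hasFDerivAt_symm_of_det_ne_zero {z : EuclideanSpace ℝ (Fin n)}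
    (hd : DifferentiableAt ℝ e (e.symm z)) (hdet : (fderiv ℝ e (e.symm z)).det ≠ 0) :
    DifferentiableAt ℝ e.symm z ∧
      (fderiv ℝ e.symm z).det = ((fderiv ℝ e (e.symm z)).det)⁻¹ := by
  set A := (fderiv ℝ e (e.symm z)).toContinuousLinearEquivOfDetNeZero hdet with hA
  have hA' : (A : EuclideanSpace ℝ (Fin n) →L[ℝ] EuclideanSpace ℝ (Fin n)) =
      fderiv ℝ e (e.symm z) := ContinuousLinearMap.coe_toContinuousLinearEquivOfDetNeZero _ _
  have h1 : HasFDerivAt e.symm (A.symm : EuclideanSpace ℝ (Fin n) →L[ℝ] _) z :=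
    HasFDerivAt.of_local_left_inverse e.symm.continuous.continuousAt
      (by rw [hA']; exact hd.hasFDerivAt) (Filter.Eventually.of_forall e.apply_symm_apply)
  refine ⟨h1.differentiableAt, ?_⟩
  rw [h1.fderiv, ← hA']
  exact ContinuousLinearEquiv.det_coe_symm A

/-- The Jacobian of `e` at the preimage of a point, in coordinates. -/
noncomputable def symmJacobian (e : EuclideanSpace ℝ (Fin n) ≃ₜ EuclideanSpace ℝ (Fin n))
    (z : Fin n → ℝ) : ℝ :=
  (fderiv ℝ e (e.symm (WithLp.toLp 2 z))).det

theorem symmJacobian_signFlip (hcomm : ∀ i x, e (coordReflection i x) = coordReflection i (e x))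
    (i : Fin n) (z : Fin n → ℝ) : symmJacobian e (signFlip i * z) = symmJacobian e z := by
  rw [symmJacobian, toLp_signFlip_mul, symm_coordReflection hcomm]
  exact det_fderiv_map_of_comm (coordReflection i).toContinuousLinearEquiv (hcomm i) _

theorem continuousOn_det_fderiv
    (hC1 : ContDiffOn ℝ 1 e {x | ∀ i, x i ≠ 0}) :
    ContinuousOn (fun x => (fderiv ℝ e x).det) {x | ∀ i, x i ≠ 0} :=
  ContinuousLinearMap.continuous_det.comp_continuousOn
    (hC1.continuousOn_fderiv_of_isOpen (isOpen_forall_coord_ne_zero n) le_rfl)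

theorem continuousAt_symmJacobian
    (hcomm : ∀ i x, e (coordReflection i x) = coordReflection i (e x))
    (hC1 : ContDiffOn ℝ 1 e {x | ∀ i, x i ≠ 0}) {z : Fin n → ℝ} (hz : ∀ i, z i ≠ 0) :
    ContinuousAt (symmJacobian e) z := by
  have hmem : e.symm (WithLp.toLp 2 z) ∈ {x : EuclideanSpace ℝ (Fin n) | ∀ i, x i ≠ 0} := by
    refine (forall_coord_ne_zero_iff hcomm _).1 ?_
    rw [e.apply_symm_apply]
    exact hz
  have h1 := (continuousOn_det_fderiv hC1).continuousAt
    ((isOpen_forall_coord_ne_zero n).mem_nhds hmem)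
  have h2 : Continuous fun z : Fin n → ℝ => e.symm (WithLp.toLp 2 z) :=
    e.symm.continuous.comp (PiLp.continuous_toLp 2 _)
  exact ContinuousAt.comp (f := fun z : Fin n → ℝ => e.symm (WithLp.toLp 2 z)) h1 h2.continuousAt

/-- By Sard's lemma the critical values of e form a null set, and the complement of a null set is
dense. -/
theorem dense_symmJacobian_ne_zero
    (hcomm : ∀ i x, e (coordReflection i x) = coordReflection i (e x))
    (hC1 : ContDiffOn ℝ 1 e {x | ∀ i, x i ≠ 0}) :
    Dense {z : Fin n → ℝ | (∀ i, z i ≠ 0) ∧ symmJacobian e z ≠ 0} := by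
  set B := {x : EuclideanSpace ℝ (Fin n) | (∀ i, x i ≠ 0) ∧ (fderiv ℝ e x).det = 0} with hB
  have hnull : volume (e '' B) = 0 := by
    refine addHaar_image_eq_zero_of_det_fderivWithin_eq_zero volume (f' := fderiv ℝ e) ?_
      fun x hx => hx.2
    intro x hx
    exact ((hC1.differentiableOn (by norm_num)).differentiableAt
      ((isOpen_forall_coord_ne_zero n).mem_nhds hx.1)).hasFDerivAt.hasFDerivWithinAt
  have hae : ∀ᵐ z : EuclideanSpace ℝ (Fin n), (∀ i, z i ≠ 0) ∧ z ∉ e '' B :=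
    (ae_forall_coord_ne_zero n).and (measure_eq_zero_iff_ae_notMem.1 hnull)
  have hae' := (PiLp.volume_preserving_toLp (Fin n)).quasiMeasurePreserving.ae hae
  refine (Measure.dense_of_ae hae').mono fun z hz => ⟨hz.1, fun h0 => hz.2 ?_⟩
  refine ⟨e.symm (WithLp.toLp 2 z), ⟨?_, h0⟩, e.apply_symm_apply _⟩
  refine (forall_coord_ne_zero_iff hcomm _).1 ?_
  rw [e.apply_symm_apply]
  exact hz.1

theorem differentiableAt_preimage
    (hcomm : ∀ i x, e (coordReflection i x) = coordReflection i (e x))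
    (hC1 : ContDiffOn ℝ 1 e {x | ∀ i, x i ≠ 0})
    {z : Fin n → ℝ} (hz : ∀ i, z i ≠ 0) :
    DifferentiableAt ℝ e (e.symm (WithLp.toLp 2 z)) := by
  refine (hC1.differentiableOn (by norm_num)).differentiableAt
    ((isOpen_forall_coord_ne_zero n).mem_nhds ((forall_coord_ne_zero_iff hcomm _).1 ?_))
  rw [e.apply_symm_apply]
  exact hz

/-- Where the Jacobian of e is nonzero, the inverse is differentiable with reciprocal Jacobian, so
such points belong to the set on which `hanti` speaks. -/
theorem inv_symmJacobian_le
    (hcomm : ∀ i x, e (coordReflection i x) = coordReflection i (e x))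
    (hC1 : ContDiffOn ℝ 1 e {x | ∀ i, x i ≠ 0})
    (hanti : ∀ i : Fin n, ∀ x' : EuclideanSpace ℝ (Fin n), x' i = 0 →
      AntitoneOn (fun t : ℝ => (fderiv ℝ e.symm (x' + t • EuclideanSpace.single i 1)).det)
        {t : ℝ | 0 ≤ t ∧ DifferentiableAt ℝ e.symm (x' + t • EuclideanSpace.single i 1)})
    {z : Fin n → ℝ} (i : Fin n) {s t : ℝ} (hs0 : 0 ≤ s) (hst : s ≤ t)
    (hs : ∀ j, Function.update z i s j ≠ 0) (ht : ∀ j, Function.update z i t j ≠ 0)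
    (hs' : symmJacobian e (Function.update z i s) ≠ 0)
    (ht' : symmJacobian e (Function.update z i t) ≠ 0) :
    (symmJacobian e (Function.update z i t))⁻¹ ≤ (symmJacobian e (Function.update z i s))⁻¹ := by
  have h1 := hasFDerivAt_symm_of_det_ne_zero (differentiableAt_preimage hcomm hC1 hs) hs'
  have h2 := hasFDerivAt_symm_of_det_ne_zero (differentiableAt_preimage hcomm hC1 ht) ht'
  have h3 := hanti i (WithLp.toLp 2 (Function.update z i 0)) (by simp)
    (a := s) ⟨hs0, by rw [toLp_update_zero_add_smul_single]; exact h1.1⟩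
    (b := t) ⟨hs0.trans hst, by rw [toLp_update_zero_add_smul_single]; exact h2.1⟩ hst
  simp only [toLp_update_zero_add_smul_single] at h3
  rwa [h1.2, h2.2] at h3

theorem symmJacobian_nonneg
    (hcomm : ∀ i x, e (coordReflection i x) = coordReflection i (e x))
    (hmono : ∀ x y, 0 ≤ inner ℝ (e y - e x) (y - x))
    (hC1 : ContDiffOn ℝ 1 e {x | ∀ i, x i ≠ 0})
    {z : Fin n → ℝ} (hz : ∀ i, z i ≠ 0) : 0 ≤ symmJacobian e z :=
  det_fderiv_nonneg_of_monotone hmono (differentiableAt_preimage hcomm hC1 hz)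

/-- Sign invariance reduces to the positive orthant, where `ne_zero_of_inv_antitone` excludes zeros.
Hence e.symm is differentiable at all points off the hyperplanes, as the change of variables needs.
-/
theorem symmJacobian_pos
    (hcomm : ∀ i x, e (coordReflection i x) = coordReflection i (e x))
    (hmono : ∀ x y, 0 ≤ inner ℝ (e y - e x) (y - x))
    (hC1 : ContDiffOn ℝ 1 e {x | ∀ i, x i ≠ 0})
    (hanti : ∀ i : Fin n, ∀ x' : EuclideanSpace ℝ (Fin n), x' i = 0 →
      AntitoneOn (fun t : ℝ => (fderiv ℝ e.symm (x' + t • EuclideanSpace.single i 1)).det)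
        {t : ℝ | 0 ≤ t ∧ DifferentiableAt ℝ e.symm (x' + t • EuclideanSpace.single i 1)})
    {z : Fin n → ℝ} (hz : ∀ i, z i ≠ 0) : 0 < symmJacobian e z := by
  refine lt_of_le_of_ne (symmJacobian_nonneg hcomm hmono hC1 hz) (Ne.symm ?_)
  rw [← apply_abs_of_reflection_invariant (symmJacobian_signFlip hcomm) z]
  refine ne_zero_of_inv_antitone (A := {z | (∀ i, z i ≠ 0) ∧ symmJacobian e z ≠ 0}) ?_
    (dense_symmJacobian_ne_zero hcomm hC1)
    (fun z hz => continuousAt_symmJacobian hcomm hC1 fun i => (hz i).ne')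
    (fun z hz => lt_of_le_of_ne (symmJacobian_nonneg hcomm hmono hC1 hz.1) hz.2.symm) ?_ _
    fun i => abs_pos.2 (hz i)
  · rw [isOpen_iff_mem_nhds]
    intro z hz
    refine Filter.Eventually.and ?_
      ((continuousAt_symmJacobian hcomm hC1 hz.1).eventually_ne hz.2)
    exact Filter.eventually_all.2 fun i => (continuous_apply i).continuousAt.eventually_ne (hz.1 i)
  · intro z hz i t ht hzi hit
    have := inv_symmJacobian_le hcomm hC1 hanti (z := z) i hzi.le hit
      (by rw [Function.update_eq_self]; exact hz.1) ht.1
      (by rw [Function.update_eq_self]; exact hz.2) ht.2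
    rwa [Function.update_eq_self] at this

theorem measurable_symmJacobian : Measurable (symmJacobian e) :=
  (ContinuousLinearMap.continuous_det.measurable.comp (measurable_fderiv ℝ e)).comp
    (e.symm.continuous.comp (PiLp.continuous_toLp 2 _)).measurable

/-- The image of Lebesgue measure under `e` has a density that decreases in the absolute value of
each coordinate. -/
theorem exists_density
    (hcomm : ∀ i x, e (coordReflection i x) = coordReflection i (e x))
    (hmono : ∀ x y, 0 ≤ inner ℝ (e y - e x) (y - x))
    (hC1 : ContDiffOn ℝ 1 e {x | ∀ i, x i ≠ 0})
    (hanti : ∀ i : Fin n, ∀ x' : EuclideanSpace ℝ (Fin n), x' i = 0 →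
      AntitoneOn (fun t : ℝ => (fderiv ℝ e.symm (x' + t • EuclideanSpace.single i 1)).det)
        {t : ℝ | 0 ≤ t ∧ DifferentiableAt ℝ e.symm (x' + t • EuclideanSpace.single i 1)}) :
    ∃ ω : (Fin n → ℝ) → ℝ, Measurable ω ∧ (∀ z, 0 ≤ ω z) ∧
    (∀ z i t, t ≠ 0 → |t| ≤ |z i| → ω z ≤ ω (Function.update z i t)) ∧
    ∀ g : (Fin n → ℝ) → ℝ≥0∞, ∫⁻ y : Fin n → ℝ, g (WithLp.ofLp (e (WithLp.toLp 2 y))) =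
      ∫⁻ z, g z * ENNReal.ofReal (ω z) := by
  have hpos := fun {z} => symmJacobian_pos hcomm hmono hC1 hanti (z := z)
  have hU : MeasurableSet {z : Fin n → ℝ | ∀ i, z i ≠ 0} := by
    simp only [ofPred_forall]
    exact MeasurableSet.iInter fun i =>
      (measurableSet_singleton (0 : ℝ)).compl.preimage (measurable_pi_apply i)
  have hω0 : ∀ z, 0 ≤ ({z : Fin n → ℝ | ∀ i, z i ≠ 0}.indicator
      fun z => (symmJacobian e z)⁻¹) z :=
    indicator_nonneg fun z hz => inv_nonneg.2 (hpos hz).le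
  -- The weight is set to 0 on the null coordinate hyperplanes, hence the exclusion of t = 0 from
  -- its monotonicity.
  refine ⟨{z | ∀ i, z i ≠ 0}.indicator fun z => (symmJacobian e z)⁻¹,
    measurable_symmJacobian.inv.indicator hU, hω0, ?_, ?_⟩
  · intro z i t ht htz
    by_cases hz : ∀ i, z i ≠ 0
    · have hup : ∀ s ≠ 0, ∀ j, Function.update z i s j ≠ 0 := by
        intro s hs j
        by_cases hj : j = i
        · subst hj; simpa using hs
        · simpa [hj] using hz j
      rw [indicator_of_mem (show z ∈ {z : Fin n → ℝ | ∀ i, z i ≠ 0} from hz),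
        indicator_of_mem (show Function.update z i t ∈ {z : Fin n → ℝ | ∀ i, z i ≠ 0} from hup t ht)]
      have h1 := hup _ (abs_ne_zero.2 ht)
      have h2 := hup _ (abs_ne_zero.2 (hz i))
      have h3 := inv_symmJacobian_le hcomm hC1 hanti i (abs_nonneg t) htz h1 h2 (hpos h1).ne'
        (hpos h2).ne'
      rw [apply_update_abs i (symmJacobian_signFlip hcomm i),
        apply_update_abs i (symmJacobian_signFlip hcomm i), Function.update_eq_self] at h3
      exact h3
    · rw [indicator_of_notMem (show z ∉ {z : Fin n → ℝ | ∀ i, z i ≠ 0} from hz)]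
      exact hω0 _
  · intro g
    set U := {x : EuclideanSpace ℝ (Fin n) | ∀ i, x i ≠ 0} with hUdef
    have hUo : IsOpen U := isOpen_forall_coord_ne_zero n
    have himg : e.symm '' U = U := by
      ext x
      constructor
      · rintro ⟨z, hz, rfl⟩
        refine (forall_coord_ne_zero_iff hcomm _).1 ?_
        rw [e.apply_symm_apply]
        exact hz
      · intro hx
        exact ⟨e x, (forall_coord_ne_zero_iff hcomm x).2 hx, e.symm_apply_apply x⟩
    have hrU : ∀ f : EuclideanSpace ℝ (Fin n) → ℝ≥0∞, ∫⁻ x in U, f x = ∫⁻ x, f x := by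
      intro f
      have h : ∀ᵐ x : EuclideanSpace ℝ (Fin n), x ∈ U := ae_forall_coord_ne_zero n
      rw [Measure.restrict_eq_self_of_ae_mem h]
    have hder : ∀ z ∈ U, DifferentiableAt ℝ e.symm z ∧
        (fderiv ℝ e.symm z).det = (symmJacobian e (WithLp.ofLp z))⁻¹ := fun z hz =>
      hasFDerivAt_symm_of_det_ne_zero (z := z)
        (differentiableAt_preimage hcomm hC1 (z := WithLp.ofLp z) hz) (hpos (z := WithLp.ofLp z) hz).ne'
    have key := lintegral_image_eq_lintegral_abs_det_fderiv_mul volume hUo.measurableSet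
      (fun z hz => (hder z hz).1.hasFDerivAt.hasFDerivWithinAt) e.symm.injective.injOn
      (fun y => g (WithLp.ofLp (e y)))
    rw [himg, hrU] at key
    rw [← lintegral_euclideanSpace (fun y => g (WithLp.ofLp (e y))), key]
    have : ∫⁻ z : Fin n → ℝ, g z * ENNReal.ofReal
        (({z : Fin n → ℝ | ∀ i, z i ≠ 0}.indicator fun z => (symmJacobian e z)⁻¹) z) =
        ∫⁻ z : EuclideanSpace ℝ (Fin n), g (WithLp.ofLp z) * ENNReal.ofReal
        (({z : Fin n → ℝ | ∀ i, z i ≠ 0}.indicator fun z => (symmJacobian e z)⁻¹) (WithLp.ofLp z)) :=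
      (lintegral_euclideanSpace fun z => g (WithLp.ofLp z) * ENNReal.ofReal
        (({z : Fin n → ℝ | ∀ i, z i ≠ 0}.indicator fun z => (symmJacobian e z)⁻¹)
          (WithLp.ofLp z))).symm
    rw [this, ← hrU]
    refine setLIntegral_congr_fun hUo.measurableSet fun z hz => ?_
    have hz' : WithLp.ofLp z ∈ {z : Fin n → ℝ | ∀ i, z i ≠ 0} := hz
    simp only [(hder z hz).2, e.apply_symm_apply, indicator_of_mem hz']
    rw [abs_of_pos (inv_pos.2 (hpos hz')), mul_comm]

end Density

/-! ### From the Legendre transform to polars, and the conclusion. -/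

theorem exp_neg_mul_exp_neg_legendre_le {n : ℕ} {Φ : EuclideanSpace ℝ (Fin n) → EReal}
    (x z : EuclideanSpace ℝ (Fin n)) (hx : Φ x ≠ ⊥) :
    EReal.exp (-Φ x) * EReal.exp (-legendre Φ z) ≤ ENNReal.ofReal (Real.exp (-inner ℝ x z)) := by
  have h1 : ((inner ℝ x z : ℝ) : EReal) - Φ x ≤ legendre Φ z :=
    le_iSup (fun x => ((inner ℝ x z : ℝ) : EReal) - Φ x) x
  rcases eq_or_ne (Φ x) ⊤ with hT | hT
  · simp [hT]
  · lift Φ x to ℝ using ⟨hT, hx⟩ with r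
    rw [← EReal.coe_sub] at h1
    have h2 : EReal.exp (-legendre Φ z) ≤ EReal.exp ((-(inner ℝ x z - r) : ℝ) : EReal) := by
      refine EReal.exp_monotone ?_
      rw [EReal.coe_neg]
      exact EReal.neg_le_neg_iff.2 h1
    refine (mul_le_mul_right h2 _).trans (le_of_eq ?_)
    rw [← EReal.coe_neg, EReal.exp_coe, EReal.exp_coe, ← ENNReal.ofReal_mul (by positivity),
      ← Real.exp_add]
    congr 2
    ring

theorem exp_neg_mul_legendre {n : ℕ} (c : ℝ) (Φ : EuclideanSpace ℝ (Fin n) → EReal)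
    (z : EuclideanSpace ℝ (Fin n)) :
    EReal.exp (-((c : EReal) * legendre Φ z)) = EReal.exp (-legendre Φ z) ^ c := by
  rw [← EReal.exp_mul, EReal.neg_mul, mul_comm]

theorem inner_toLp_toLp {n : ℕ} (x z : Fin n → ℝ) :
    inner ℝ (WithLp.toLp 2 x : EuclideanSpace ℝ (Fin n)) (WithLp.toLp 2 z) = x ⬝ᵥ z := by
  rw [EuclideanSpace.inner_eq_star_dotProduct, dotProduct_comm]
  simp

/-- The functional is increased by passing to multiplicative polars. -/
theorem blaschkeSantalo_le_polarFun {n : ℕ} {p : ℝ} (hp : 1 < p)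
    (V : EuclideanSpace ℝ (Fin n) → ℝ) {Φ : EuclideanSpace ℝ (Fin n) → EReal}
    (hΦ : ∀ x, Φ x ≠ ⊥) {F : (Fin n → ℝ) → ℝ≥0∞}
    (hF : F = fun x => EReal.exp (-Φ (WithLp.toLp 2 x))) :
    blaschkeSantalo p V Φ ≤ (∫⁻ x, polarFun (polarFun F) x) *
      (∫⁻ y : Fin n → ℝ, polarFun F (WithLp.ofLp (∇ V (WithLp.toLp 2 y))) ^ (1 / (p - 1))) ^ (p - 1) := by
  have hp1 : 0 < p - 1 := by linarith
  rw [blaschkeSantalo, lintegral_euclideanSpace, lintegral_euclideanSpace]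
  gcongr with x y
  · exact (congrFun hF x).symm.le.trans (le_polarFun_polarFun F x)
  · rw [exp_neg_mul_legendre]
    refine ENNReal.rpow_le_rpow (le_polarFun_iff.2 fun x => ?_) (by positivity)
    have := exp_neg_mul_exp_neg_legendre_le (WithLp.toLp 2 x) (∇ V (WithLp.toLp 2 y))
      (hΦ (WithLp.toLp 2 x))
    rw [hF, mul_comm, dotProduct_comm, ← inner_toLp_toLp]
    exact this

theorem theoremA {n : ℕ} (p : ℝ) (hp : 1 < p) (V : EuclideanSpace ℝ (Fin n) → ℝ)
    (hV_even : ∀ x, V (-x) = V x)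
    (hV_convex : StrictConvexOn ℝ univ V)
    (hV_hom : ∀ c : ℝ, 0 < c → ∀ x, V (c • x) = c ^ p * V x)
    (hV_C1 : ContDiff ℝ 1 V)
    (hV_C2 : ContDiffOn ℝ 2 V {x | ∀ i, x i ≠ 0})
    (hV_unc : IsUnconditional V)
    (hV_conc : ConcaveOn ℝ {x : EuclideanSpace ℝ (Fin n) | ∀ i, 0 ≤ x i}
      (fun x => V (WithLp.toLp 2 (fun i => x i ^ (1 / p))))) :
    (∀ Φ : EuclideanSpace ℝ (Fin n) → EReal, IsProperConvex Φ → IsUnconditional Φ →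
      blaschkeSantalo p V Φ ≤ (∫⁻ x, ENNReal.ofReal (Real.exp (-V x))) ^ p) ∧
    ((∀ i : Fin n, ∀ x' : EuclideanSpace ℝ (Fin n), x' i = 0 →
        AntitoneOn (fun t : ℝ => hessianDet (legendreReal V) (x' + t • EuclideanSpace.single i 1))
          {t : ℝ | 0 ≤ t ∧
            HasHessianAt (legendreReal V) (x' + t • EuclideanSpace.single i 1)}) →
      ∀ Φ : EuclideanSpace ℝ (Fin n) → EReal, IsProperConvex Φ → (∀ x, Φ (-x) = Φ x) →
        blaschkeSantalo p V Φ ≤ (∫⁻ x, ENNReal.ofReal (Real.exp (-V x))) ^ p) := by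
  have hd : Differentiable ℝ V := hV_C1.differentiable (by norm_num)
  have hVR : ∀ i x, ∇ V (coordReflection i x) = coordReflection i (∇ V x) := fun i =>
    gradient_map_of_comp_eq (coordReflection i) (hV_unc.comp_coordReflection i)
  let D : (Fin n → ℝ) → (Fin n → ℝ) := fun y => WithLp.ofLp (∇ V (WithLp.toLp 2 y))
  have hD : Measurable D :=
    ((PiLp.continuous_ofLp 2 _).comp
      (hV_C1.continuous_gradient.comp (PiLp.continuous_toLp 2 _))).measurable
  have hDu : ∀ y i, |D (fun j => |y j|) i| = |D y i| := by
    intro y i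
    refine apply_abs_of_reflection_invariant (G := fun y => |D y i|) (fun j z => ?_) y
    simp only [D, toLp_signFlip_mul, hVR, ofLp_coordReflection]
    by_cases hj : i = j
    · subst hj; simp [signFlip]
    · simp [signFlip, hj]
  have hv : Measurable fun x : Fin n → ℝ => V (WithLp.toLp 2 x) :=
    (hd.continuous.comp (PiLp.continuous_toLp 2 _)).measurable
  have hvu : ∀ x : Fin n → ℝ, V (WithLp.toLp 2 fun i => |x i|) = V (WithLp.toLp 2 x) :=
    fun x => hV_unc _ _ fun i => by simp
  have H := apply_geomMean_le hp hV_hom hd hV_conc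
  refine ⟨fun Φ hΦ hΦu => ?_, fun hanti Φ hΦ hΦe => ?_⟩
  -- Both polars are measurable and inherit the sign symmetries of Φ.
  · refine (blaschkeSantalo_le_polarFun hp V hΦ.ne_bot rfl).trans ?_
    rw [lintegral_euclideanSpace]
    have hFs : ∀ i x, EReal.exp (-Φ (WithLp.toLp 2 (signFlip i * x))) =
        EReal.exp (-Φ (WithLp.toLp 2 x)) := fun i x => by
      rw [toLp_signFlip_mul, hΦu.comp_coordReflection]
    have hG := fun i => polarFun_mul_sign
      (G := fun x => EReal.exp (-Φ (WithLp.toLp 2 x))) (signFlip_mul_self i) (hFs i)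
    have hGu := apply_abs_of_reflection_invariant hG
    exact blaschkeSantalo_of_unconditional hp hv hvu hD H (measurable_polarFun _)
      (measurable_polarFun _)
      (apply_abs_of_reflection_invariant fun i => polarFun_mul_sign (signFlip_mul_self i) (hG i))
      (fun y => by rw [← hGu, ← hGu (D y)]; simp only [hDu]) (polarFun_mul_le _)
  · refine (blaschkeSantalo_le_polarFun hp V hΦ.ne_bot rfl).trans ?_
    rw [lintegral_euclideanSpace]
    let e := gradientHomeomorph hp hV_even hV_convex hV_hom hV_C1
    have he : ⇑e = ∇ V := rfl
    -- Since ∇V* inverts ∇V, the assumption on det D²V* becomes one on the Jacobian of e.symm.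
    have hW : ∇ (legendreReal V) = e.symm := gradient_eq
      (hasGradientAt_legendreReal hV_convex.convexOn hd e.symm.continuous e.apply_symm_apply)
    have hC1 : ContDiffOn ℝ 1 e {x | ∀ i, x i ≠ 0} :=
      (InnerProductSpace.toDual ℝ (EuclideanSpace ℝ (Fin n))).symm.contDiff.comp_contDiffOn
        (hV_C2.fderiv_of_isOpen (isOpen_forall_coord_ne_zero n) (by norm_num))
    simp only [hessianDet, HasHessianAt, hW] at hanti
    obtain ⟨ω, hω, hω0, hωs, hωD⟩ := exists_density (e := e) hVR
      (gradient_monotone hV_convex.convexOn hd) hC1 hanti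
    refine blaschkeSantalo_of_even hp hv hvu hD hDu H hω hω0 hωs (fun g _ => hωD g)
      (measurable_polarFun _) fun z => ?_
    have := polarFun_mul_sign (ε := -1) (G := fun x => EReal.exp (-Φ (WithLp.toLp 2 x))) (by simp)
      (fun z => by rw [neg_one_mul, WithLp.toLp_neg, hΦe]) z
    rwa [neg_one_mul] at this
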